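/- A prop is a strict symmetric monoidal category whose objects are the natural numbers, with $n\otimes m=n+m$; $\mathsf{PROP}$ is the category of props and identity-on-objects strict symmetric monoidal functors. Write $[n]=\{0,\dots,n-1\}$. Let $\mathsf{PF}$ be the prop whose arrows $n\to m$ are the partial functions $[n]\rightharpoonup[m]$, and $\mathsf{Inj}$ its sub-prop of (total) injective functions, both with disjoint union as monoidal product. Let $\mathsf{Cospan}(\mathsf{PF})$ be the prop of isomorphism classes of cospans in $\mathsf{PF}$, composed by pushout, and $\mathsf{Span}(\mathsf{Inj})$ the prop of isomorphism classes of spans in $\mathsf{Inj}$, composed by pullback. Let $\mathsf{Corel}(\mathsf{PF})$ be the prop of corelations with respect to the costable factorisation system (partial surjections, injections) on $\mathsf{PF}$: its arrows $n\to m$ are the classes of cospans $n\to k\leftarrow m$ in $\mathsf{PF}$ under the equivalence relation generated by relating two cospans when an injection between their apexes commutes with the legs; composition is by pushout. Let $\Gamma:\mathsf{Cospan}(\mathsf{PF})\to\mathsf{Corel}(\mathsf{PF})$ send a cospan to its class. Let $\mathsf{PER}$ be the prop whose arrows $n\to m$ are the partial equivalence relations (symmetric, transitive relations) on $[n]\uplus[m]$.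 The composite of $e_1:n\to z$ and $e_2:z\to m$ is obtained by gluing and restricting, with undefinedness propagating: if $G$ denotes the transitive closure of $e_1\cup e_2$ on $[n]\uplus[z]\uplus[m]$, then $x$ and $y$ in $[n]\uplus[m]$ are related by $e_1;e_2$ iff $x\mathrel{G}y$ and every $w\in[z]$ with $x\mathrel{G}w$ lies in the domain of both $e_1$ and $e_2$ (that is, $w\mathrel{e_1}w$ and $w\mathrel{e_2}w$). The monoidal product is disjoint union, and the identities and symmetries are the partial equivalence relations that identify each element with its image under the identity, respectively under the block permutation. Then: 1. There is an isomorphism of props $\varphi:\mathsf{Corel}(\mathsf{PF})\cong\mathsf{PER}$ sending the class of a cospan $n\xrightarrow{f}k\xleftarrow{g}m$ to the partial equivalence relation that relates $x,y\in[n]\uplus[m]$ iff the copairing $[f,g]$ is defined at $x$ and at $y$ and takes the same value at both. 2. There is a morphism of props $\Pi:\mathsf{Span}(\mathsf{Inj})\to\mathsf{Corel}(\mathsf{PF})$ sending the class of a span to the class of its pushout cospan in $\mathsf{PF}$, and the squares $$\begin{array}{ccc}\mathsf{Inj}+\mathsf{Inj}^{\mathrm{op}}&\longrightarrow&\mathsf{Span}(\mathsf{Inj})\\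 \downarrow&&\downarrow{\scriptstyle\Pi}\\ \mathsf{Cospan}(\mathsf{PF})&\xrightarrow{\ \Gamma\ }&\mathsf{Corel}(\mathsf{PF})\end{array}\qquad\qquad\begin{array}{ccc}\mathsf{Inj}+\mathsf{Inj}^{\mathrm{op}}&\longrightarrow&\mathsf{Span}(\mathsf{Inj})\\ \downarrow&&\downarrow{\scriptstyle\varphi\Pi}\\ \mathsf{Cospan}(\mathsf{PF})&\xrightarrow{\varphi\Gamma}&\mathsf{PER}\end{array}$$ are pushouts in $\mathsf{PROP}$. Here $+$ is the coproduct of props, and the maps out of it are the copairings of the canonical ones: $f\mapsto(\xrightarrow{f}\xleftarrow{\mathrm{id}})$ and $g\mapsto(\xrightarrow{\mathrm{id}}\xleftarrow{g})$ into cospans, $f\mapsto(\xleftarrow{\mathrm{id}}\xrightarrow{f})$ and $g\mapsto(\xleftarrow{g}\xrightarrow{\mathrm{id}})$ into spans. -/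

import Mathlib

open CategoryTheory Limits

/-- The arrow `a ⟶ b` obtained from the identity when `a = b`. -/
def eqArrow {H : ℕ → ℕ → Type} (i : ∀ a, H a a) {a b : ℕ} (h : a = b) : H a b := h ▸ i a

/-- A prop: a strict symmetric monoidal category whose objects are the natural numbers, with
`n ⊗ m = n + m`.  The associators and unitors are identities, i.e. the arrows `eqArrow`. -/
structure PROP where
  Hom : ℕ → ℕ → Type
  id (a : ℕ) : Hom a a
  /-- Composition in diagrammatic order. -/
  comp {a b c : ℕ} : Hom a b → Hom b c → Hom a c
  id_comp {a b : ℕ} (f : Hom a b) : comp (id a) f = f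
  comp_id {a b : ℕ} (f : Hom a b) : comp f (id b) = f
  assoc {a b c d : ℕ} (f : Hom a b) (g : Hom b c) (h : Hom c d) :
    comp (comp f g) h = comp f (comp g h)
  tensor {a b c d : ℕ} : Hom a b → Hom c d → Hom (a + c) (b + d)
  tensor_id (a b : ℕ) : tensor (id a) (id b) = id (a + b)
  tensor_comp {a b c a' b' c' : ℕ} (f : Hom a b) (g : Hom b c) (f' : Hom a' b') (g' : Hom b' c') :
    tensor (comp f g) (comp f' g') = comp (tensor f f') (tensor g g')
  tensor_assoc {a b a' b' a'' b'' : ℕ} (f : Hom a b) (g : Hom a' b') (h : Hom a'' b'') :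
    comp (tensor (tensor f g) h) (eqArrow id (Nat.add_assoc b b' b'')) =
      comp (eqArrow id (Nat.add_assoc a a' a'')) (tensor f (tensor g h))
  unit_tensor {a b : ℕ} (f : Hom a b) :
    comp (tensor (id 0) f) (eqArrow id (Nat.zero_add b)) = comp (eqArrow id (Nat.zero_add a)) f
  tensor_unit {a b : ℕ} (f : Hom a b) :
    comp (tensor f (id 0)) (eqArrow id (Nat.add_zero b)) = comp (eqArrow id (Nat.add_zero a)) f
  symm (a b : ℕ) : Hom (a + b) (b + a)
  symm_natural {a b a' b' : ℕ} (f : Hom a b) (g : Hom a' b') :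
    comp (tensor f g) (symm b b') = comp (symm a a') (tensor g f)
  symm_symm (a b : ℕ) : comp (symm a b) (symm b a) = id (a + b)
  hexagon (a b c : ℕ) :
    comp (comp (eqArrow id (Nat.add_assoc a b c)) (symm a (b + c)))
        (eqArrow id (Nat.add_assoc b c a)) =
      comp (comp (tensor (symm a b) (id c)) (eqArrow id (Nat.add_assoc b a c)))
        (tensor (id b) (symm a c))

namespace PROP

/-- Morphisms of props: identity-on-objects strict symmetric monoidal functors. -/
@[ext] structure Mor (P Q : PROP) where
  map {a b : ℕ} : P.Hom a b → Q.Hom a b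
  map_id (a : ℕ) : map (P.id a) = Q.id a
  map_comp {a b c : ℕ} (f : P.Hom a b) (g : P.Hom b c) :
    map (P.comp f g) = Q.comp (map f) (map g)
  map_tensor {a b c d : ℕ} (f : P.Hom a b) (g : P.Hom c d) :
    map (P.tensor f g) = Q.tensor (map f) (map g)
  map_symm (a b : ℕ) : map (P.symm a b) = Q.symm a b

/-- The category of props. -/
instance : Category PROP where
  Hom := Mor
  id P := ⟨fun f => f, fun _ => rfl, fun _ _ => rfl, fun _ _ => rfl, fun _ _ => rfl⟩
  comp F G :=
    ⟨fun f => G.map (F.map f), fun a => by rw [F.map_id, G.map_id],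
      fun f g => by rw [F.map_comp, G.map_comp], fun f g => by rw [F.map_tensor, G.map_tensor],
      fun a b => by rw [F.map_symm, G.map_symm]⟩

theorem hom_ext {P Q : PROP} {F G : P ⟶ Q}
    (h : ∀ {a b : ℕ} (f : P.Hom a b), F.map f = G.map f) : F = G :=
  Mor.ext (by funext a b f; exact h f)

theorem Mor.map_eqArrow {P Q : PROP} (F : Mor P Q) {a b : ℕ} (h : a = b) :
    F.map (eqArrow P.id h) = eqArrow Q.id h := by
  cases h; exact F.map_id a

/-- The objects of a prop, i.e. the natural numbers, carrying the underlying category. -/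
def Ob (_ : PROP) : Type := ℕ

instance (C : PROP) : Category C.Ob where
  Hom a b := C.Hom a b
  id a := C.id a
  comp f g := C.comp f g
  id_comp := C.id_comp
  comp_id := C.comp_id
  assoc := C.assoc

theorem eqArrow_comp (C : PROP) {a b c : ℕ} (h : a = b) (h' : b = c) :
    C.comp (eqArrow C.id h) (eqArrow C.id h') = eqArrow C.id (h.trans h') := by
  cases h; exact C.id_comp _

/-- Two arrows with equal inverses are equal. -/
theorem eq_of_inv (C : PROP) {a b : ℕ} {l r : C.Hom a b} {l' r' : C.Hom b a}
    (hl : C.comp l l' = C.id a) (hr : C.comp r' r = C.id b) (h : l = r) : l' = r' := by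
  subst h
  calc l' = C.comp (C.comp r' l) l' := by rw [hr, C.id_comp]
    _ = r' := by rw [C.assoc, hl, C.comp_id]

theorem inv_comp (C : PROP) {a b c : ℕ} {f : C.Hom a b} {g : C.Hom b c} {f' : C.Hom b a}
    {g' : C.Hom c b} (hf : C.comp f f' = C.id a) (hg : C.comp g g' = C.id b) :
    C.comp (C.comp f g) (C.comp g' f') = C.id a := by
  rw [C.assoc, ← C.assoc g, hg, C.id_comp, hf]

theorem eqArrow_inv (C : PROP) {a b : ℕ} (h : a = b) :
    C.comp (eqArrow C.id h) (eqArrow C.id h.symm) = C.id a := by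
  rw [eqArrow_comp]; rfl

theorem tensor_inv (C : PROP) {a b c d : ℕ} {f : C.Hom a b} {g : C.Hom c d} {f' : C.Hom b a}
    {g' : C.Hom d c} (hf : C.comp f f' = C.id a) (hg : C.comp g g' = C.id c) :
    C.comp (C.tensor f g) (C.tensor f' g') = C.id (a + c) := by
  rw [← C.tensor_comp, hf, hg, C.tensor_id]

theorem eqArrow_op (C : PROP) {a b : ℕ} (h : a = b) :
    eqArrow (H := fun a b => C.Hom b a) C.id h = eqArrow C.id h.symm := by
  cases h; rfl

theorem swap_eqArrow (C : PROP) {a b c d : ℕ} (h : a = b) (h' : c = d) (f : C.Hom a c)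
    (g : C.Hom b d) (e : C.comp f (eqArrow C.id h') = C.comp (eqArrow C.id h) g) :
    C.comp (eqArrow C.id h.symm) f = C.comp g (eqArrow C.id h'.symm) := by
  cases h; cases h'
  simpa [eqArrow, C.comp_id, C.id_comp] using e

/-- The opposite prop. -/
def op (C : PROP) : PROP where
  Hom a b := C.Hom b a
  id a := C.id a
  comp f g := C.comp g f
  id_comp f := C.comp_id f
  comp_id f := C.id_comp f
  assoc f g h := (C.assoc h g f).symm
  tensor f g := C.tensor f g
  tensor_id := C.tensor_id
  tensor_comp f g f' g' := C.tensor_comp g f g' f'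
  tensor_assoc f g h := by
    rw [eqArrow_op, eqArrow_op]
    exact C.swap_eqArrow _ _ _ _ (C.tensor_assoc f g h)
  unit_tensor f := by
    rw [eqArrow_op, eqArrow_op]
    exact C.swap_eqArrow _ _ _ _ (C.unit_tensor f)
  tensor_unit f := by
    rw [eqArrow_op, eqArrow_op]
    exact C.swap_eqArrow _ _ _ _ (C.tensor_unit f)
  symm a b := C.symm b a
  symm_natural f g := (C.symm_natural g f).symm
  symm_symm a b := C.symm_symm a b
  hexagon a b c := by
    simp only [eqArrow_op]
    refine C.eq_of_inv (C.inv_comp (C.inv_comp (C.eqArrow_inv _) (C.symm_symm _ _))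
      (C.eqArrow_inv _)) ?_ (C.hexagon a b c)
    exact C.inv_comp (C.tensor_inv (C.id_comp _) (C.symm_symm _ _)) (C.inv_comp
      (C.eqArrow_inv (Nat.add_assoc b a c).symm) (C.tensor_inv (C.symm_symm _ _) (C.id_comp _)))

/-- The opposite of a morphism of props. -/
def Mor.op {P Q : PROP} (F : P ⟶ Q) : P.op ⟶ Q.op :=
  Mor.mk (P := P.op) (Q := Q.op) (fun f => F.map f) F.map_id (fun f g => F.map_comp g f)
    (fun f g => F.map_tensor f g) (fun a b => F.map_symm b a)

/-! ### Coproducts of props -/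

/-- Formal expressions built from the arrows of two props. -/
inductive Term (P Q : PROP) : ℕ → ℕ → Type
  | inl {a b : ℕ} (f : P.Hom a b) : Term P Q a b
  | inr {a b : ℕ} (f : Q.Hom a b) : Term P Q a b
  | id (a : ℕ) : Term P Q a a
  | comp {a b c : ℕ} (f : Term P Q a b) (g : Term P Q b c) : Term P Q a c
  | tensor {a b c d : ℕ} (f : Term P Q a b) (g : Term P Q c d) : Term P Q (a + c) (b + d)
  | symm (a b : ℕ) : Term P Q (a + b) (b + a)

/-- The congruence generated by the axioms of props and by the requirement that the two
inclusions be morphisms of props. -/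
inductive TermRel (P Q : PROP) : ∀ {a b : ℕ}, Term P Q a b → Term P Q a b → Prop
  | refl {a b : ℕ} (f : Term P Q a b) : TermRel P Q f f
  | sym {a b : ℕ} {f g : Term P Q a b} : TermRel P Q f g → TermRel P Q g f
  | trans {a b : ℕ} {f g h : Term P Q a b} : TermRel P Q f g → TermRel P Q g h → TermRel P Q f h
  | comp_congr {a b c : ℕ} {f f' : Term P Q a b} {g g' : Term P Q b c} :
      TermRel P Q f f' → TermRel P Q g g' → TermRel P Q (f.comp g) (f'.comp g')
  | tensor_congr {a b c d : ℕ} {f f' : Term P Q a b} {g g' : Term P Q c d} :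
      TermRel P Q f f' → TermRel P Q g g' → TermRel P Q (f.tensor g) (f'.tensor g')
  | id_comp {a b : ℕ} (f : Term P Q a b) : TermRel P Q ((Term.id a).comp f) f
  | comp_id {a b : ℕ} (f : Term P Q a b) : TermRel P Q (f.comp (Term.id b)) f
  | assoc {a b c d : ℕ} (f : Term P Q a b) (g : Term P Q b c) (h : Term P Q c d) :
      TermRel P Q ((f.comp g).comp h) (f.comp (g.comp h))
  | tensor_id (a b : ℕ) : TermRel P Q ((Term.id a).tensor (Term.id b)) (Term.id (a + b))
  | tensor_comp {a b c a' b' c' : ℕ} (f : Term P Q a b) (g : Term P Q b c) (f' : Term P Q a' b')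
      (g' : Term P Q b' c') :
      TermRel P Q ((f.comp g).tensor (f'.comp g')) ((f.tensor f').comp (g.tensor g'))
  | tensor_assoc {a b a' b' a'' b'' : ℕ} (f : Term P Q a b) (g : Term P Q a' b')
      (h : Term P Q a'' b'') :
      TermRel P Q (((f.tensor g).tensor h).comp (eqArrow Term.id (Nat.add_assoc b b' b'')))
        ((eqArrow Term.id (Nat.add_assoc a a' a'')).comp (f.tensor (g.tensor h)))
  | unit_tensor {a b : ℕ} (f : Term P Q a b) :
      TermRel P Q (((Term.id 0).tensor f).comp (eqArrow Term.id (Nat.zero_add b)))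
        ((eqArrow Term.id (Nat.zero_add a)).comp f)
  | tensor_unit {a b : ℕ} (f : Term P Q a b) :
      TermRel P Q ((f.tensor (Term.id 0)).comp (eqArrow Term.id (Nat.add_zero b)))
        ((eqArrow Term.id (Nat.add_zero a)).comp f)
  | symm_natural {a b a' b' : ℕ} (f : Term P Q a b) (g : Term P Q a' b') :
      TermRel P Q ((f.tensor g).comp (Term.symm b b')) ((Term.symm a a').comp (g.tensor f))
  | symm_symm (a b : ℕ) : TermRel P Q ((Term.symm a b).comp (Term.symm b a)) (Term.id (a + b))
  | hexagon (a b c : ℕ) :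
      TermRel P Q
        (((eqArrow Term.id (Nat.add_assoc a b c)).comp (Term.symm a (b + c))).comp
          (eqArrow Term.id (Nat.add_assoc b c a)))
        ((((Term.symm a b).tensor (Term.id c)).comp (eqArrow Term.id (Nat.add_assoc b a c))).comp
          ((Term.id b).tensor (Term.symm a c)))
  | inl_id (a : ℕ) : TermRel P Q (Term.inl (P.id a)) (Term.id a)
  | inl_comp {a b c : ℕ} (f : P.Hom a b) (g : P.Hom b c) :
      TermRel P Q (Term.inl (P.comp f g)) ((Term.inl f).comp (Term.inl g))
  | inl_tensor {a b c d : ℕ} (f : P.Hom a b) (g : P.Hom c d) :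
      TermRel P Q (Term.inl (P.tensor f g)) ((Term.inl f).tensor (Term.inl g))
  | inl_symm (a b : ℕ) : TermRel P Q (Term.inl (P.symm a b)) (Term.symm a b)
  | inr_id (a : ℕ) : TermRel P Q (Term.inr (Q.id a)) (Term.id a)
  | inr_comp {a b c : ℕ} (f : Q.Hom a b) (g : Q.Hom b c) :
      TermRel P Q (Term.inr (Q.comp f g)) ((Term.inr f).comp (Term.inr g))
  | inr_tensor {a b c d : ℕ} (f : Q.Hom a b) (g : Q.Hom c d) :
      TermRel P Q (Term.inr (Q.tensor f g)) ((Term.inr f).tensor (Term.inr g))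
  | inr_symm (a b : ℕ) : TermRel P Q (Term.inr (Q.symm a b)) (Term.symm a b)

theorem mk_eqArrow (P Q : PROP) {a b : ℕ} (h : a = b) :
    eqArrow (H := fun a b => Quot (TermRel P Q (a := a) (b := b))) (fun a => Quot.mk _ (Term.id a)) h
      = Quot.mk _ (eqArrow Term.id h) := by
  cases h; rfl

/-- The coproduct of two props. -/
def sum (P Q : PROP) : PROP where
  Hom a b := Quot (TermRel P Q (a := a) (b := b))
  id a := Quot.mk _ (Term.id a)
  comp := Quot.map₂ Term.comp (fun f _ _ h => .comp_congr (.refl f) h)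
    (fun _ _ g h => .comp_congr h (.refl g))
  id_comp := by rintro a b ⟨f⟩; exact Quot.sound (.id_comp f)
  comp_id := by rintro a b ⟨f⟩; exact Quot.sound (.comp_id f)
  assoc := by rintro a b c d ⟨f⟩ ⟨g⟩ ⟨h⟩; exact Quot.sound (.assoc f g h)
  tensor := Quot.map₂ Term.tensor (fun f _ _ h => .tensor_congr (.refl f) h)
    (fun _ _ g h => .tensor_congr h (.refl g))
  tensor_id a b := Quot.sound (.tensor_id a b)
  tensor_comp := by
    rintro a b c a' b' c' ⟨f⟩ ⟨g⟩ ⟨f'⟩ ⟨g'⟩; exact Quot.sound (.tensor_comp f g f' g')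
  tensor_assoc := by
    rintro a b a' b' a'' b'' ⟨f⟩ ⟨g⟩ ⟨h⟩
    simp only [mk_eqArrow]; exact Quot.sound (.tensor_assoc f g h)
  unit_tensor := by
    rintro a b ⟨f⟩; simp only [mk_eqArrow]; exact Quot.sound (.unit_tensor f)
  tensor_unit := by
    rintro a b ⟨f⟩; simp only [mk_eqArrow]; exact Quot.sound (.tensor_unit f)
  symm a b := Quot.mk _ (Term.symm a b)
  symm_natural := by rintro a b a' b' ⟨f⟩ ⟨g⟩; exact Quot.sound (.symm_natural f g)
  symm_symm a b := Quot.sound (.symm_symm a b)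
  hexagon a b c := by simp only [mk_eqArrow]; exact Quot.sound (.hexagon a b c)

/-- The first inclusion into the coproduct. -/
def sumInl (P Q : PROP) : P ⟶ sum P Q :=
  Mor.mk (P := P) (Q := sum P Q) (fun f => Quot.mk _ (Term.inl f))
    (fun a => Quot.sound (.inl_id a))
    (fun f g => Quot.sound (.inl_comp f g)) (fun f g => Quot.sound (.inl_tensor f g))
    (fun a b => Quot.sound (.inl_symm a b))

/-- The second inclusion into the coproduct. -/
def sumInr (P Q : PROP) : Q ⟶ sum P Q :=
  Mor.mk (P := Q) (Q := sum P Q) (fun f => Quot.mk _ (Term.inr f))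
    (fun a => Quot.sound (.inr_id a))
    (fun f g => Quot.sound (.inr_comp f g)) (fun f g => Quot.sound (.inr_tensor f g))
    (fun a b => Quot.sound (.inr_symm a b))

/-- Interpretation of formal expressions in a third prop. -/
def Term.eval {P Q R : PROP} (F : P ⟶ R) (G : Q ⟶ R) : ∀ {a b : ℕ}, Term P Q a b → R.Hom a b
  | _, _, .inl f => F.map f
  | _, _, .inr f => G.map f
  | _, _, .id a => R.id a
  | _, _, .comp f g => R.comp (f.eval F G) (g.eval F G)
  | _, _, .tensor f g => R.tensor (f.eval F G) (g.eval F G)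
  | _, _, .symm a b => R.symm a b

theorem Term.eval_eqArrow {P Q R : PROP} (F : P ⟶ R) (G : Q ⟶ R) {a b : ℕ} (h : a = b) :
    (eqArrow (Term.id (P := P) (Q := Q)) h).eval F G = eqArrow R.id h := by
  cases h; rfl

theorem TermRel.eval {P Q R : PROP} (F : P ⟶ R) (G : Q ⟶ R) {a b : ℕ} {f g : Term P Q a b}
    (h : TermRel P Q f g) : f.eval F G = g.eval F G := by
  induction h with
  | refl => rfl
  | sym _ ih => exact ih.symm
  | trans _ _ ih ih' => exact ih.trans ih'
  | comp_congr _ _ ih ih' => simp only [Term.eval, ih, ih']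
  | tensor_congr _ _ ih ih' => simp only [Term.eval, ih, ih']
  | id_comp => exact R.id_comp _
  | comp_id => exact R.comp_id _
  | assoc => exact R.assoc _ _ _
  | tensor_id => exact R.tensor_id _ _
  | tensor_comp => exact R.tensor_comp _ _ _ _
  | tensor_assoc => simp only [Term.eval, Term.eval_eqArrow]; exact R.tensor_assoc _ _ _
  | unit_tensor => simp only [Term.eval, Term.eval_eqArrow]; exact R.unit_tensor _
  | tensor_unit => simp only [Term.eval, Term.eval_eqArrow]; exact R.tensor_unit _
  | symm_natural => exact R.symm_natural _ _
  | symm_symm => exact R.symm_symm _ _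
  | hexagon => simp only [Term.eval, Term.eval_eqArrow]; exact R.hexagon _ _ _
  | inl_id => exact F.map_id _
  | inl_comp => exact F.map_comp _ _
  | inl_tensor => exact F.map_tensor _ _
  | inl_symm => exact F.map_symm _ _
  | inr_id => exact G.map_id _
  | inr_comp => exact G.map_comp _ _
  | inr_tensor => exact G.map_tensor _ _
  | inr_symm => exact G.map_symm _ _

/-- The copairing of two morphisms of props. -/
def sumDesc {P Q R : PROP} (F : P ⟶ R) (G : Q ⟶ R) : sum P Q ⟶ R :=
  Mor.mk (P := sum P Q) (Q := R)
    (fun f => Quot.lift (fun t : Term P Q _ _ => t.eval F G) (fun _ _ h => h.eval F G) f)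
    (fun _ => rfl) (by rintro a b c ⟨f⟩ ⟨g⟩; rfl) (by rintro a b c d ⟨f⟩ ⟨g⟩; rfl)
    (fun _ _ => rfl)

theorem sumDesc_unique {P Q R : PROP} {F : P ⟶ R} {G : Q ⟶ R} (K : sum P Q ⟶ R)
    (hF : sumInl P Q ≫ K = F) (hG : sumInr P Q ≫ K = G) : K = sumDesc F G := by
  subst hF hG
  refine hom_ext ?_
  suffices h : ∀ {a b : ℕ} (t : Term P Q a b), K.map (Quot.mk _ t) = t.eval _ _ by
    rintro a b ⟨t⟩; exact h t
  intro a b t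
  induction t with
  | inl f => rfl
  | inr f => rfl
  | id a => exact K.map_id a
  | comp f g ihf ihg => exact (K.map_comp (Quot.mk _ f) (Quot.mk _ g)).trans (by rw [ihf, ihg]; rfl)
  | tensor f g ihf ihg =>
    exact (K.map_tensor (Quot.mk _ f) (Quot.mk _ g)).trans (by rw [ihf, ihg]; rfl)
  | symm a b => exact K.map_symm a b

instance : HasBinaryCoproducts PROP :=
  have (P Q : PROP) : HasColimit (pair P Q) :=
    ⟨⟨⟨BinaryCofan.mk (sumInl P Q) (sumInr P Q),
      BinaryCofan.IsColimit.mk _ (fun F G => sumDesc F G) (fun _ _ => rfl) (fun _ _ => rfl)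
        (fun _ _ K hF hG => sumDesc_unique K hF hG)⟩⟩⟩
  hasBinaryCoproducts_of_hasColimit_pair PROP

end PROP

namespace PROP

/-! ### Cospans, spans and corelations -/

/-- `C` has pushouts, and its monoidal product preserves them. -/
class TensorPushouts (C : PROP) : Prop where
  hasPushouts : HasPushouts C.Ob
  tensor {y n m p y' n' m' p' : ℕ} {f : C.Hom y n} {g : C.Hom y m} {i : C.Hom n p}
    {j : C.Hom m p} {f' : C.Hom y' n'} {g' : C.Hom y' m'} {i' : C.Hom n' p'} {j' : C.Hom m' p'} :
    IsPushout (C := C.Ob) f g i j → IsPushout (C := C.Ob) f' g' i' j' →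
      IsPushout (C := C.Ob) (C.tensor f f') (C.tensor g g') (C.tensor i i') (C.tensor j j')

/-- A class of arrows closed under the monoidal product. -/
class TensorClosed {C : PROP} (M : MorphismProperty C.Ob) : Prop where
  tensor {a b c d : ℕ} {f : C.Hom a b} {g : C.Hom c d} :
    M (X := a) (Y := b) f → M (X := c) (Y := d) g → M (X := a + c) (Y := b + d) (C.tensor f g)

/-- A cospan `a ⟶ apex ⟵ b`. -/
structure Cosp (C : PROP) (a b : ℕ) where
  apex : ℕ
  left : C.Hom a apex
  right : C.Hom b apex

/-- Two cospans are related if there is an arrow in `M` between their apexes that commutes with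
the legs. -/
def CospRel {C : PROP} (M : MorphismProperty C.Ob) {a b : ℕ} (s t : Cosp C a b) : Prop :=
  ∃ m : C.Hom s.apex t.apex, M (X := s.apex) (Y := t.apex) m ∧
    C.comp s.left m = t.left ∧ C.comp s.right m = t.right

/-- Cospans modulo the equivalence relation generated by `CospRel M`. -/
abbrev CospMod {C : PROP} (M : MorphismProperty C.Ob) (a b : ℕ) : Type :=
  Quot (CospRel M (a := a) (b := b))

section CospMod

variable {C : PROP} (M : MorphismProperty C.Ob)

/-- The class of the cospan with legs `f` and `g`. -/
def cmk {a b n : ℕ} (f : C.Hom a n) (g : C.Hom b n) : CospMod M a b := Quot.mk _ ⟨n, f, g⟩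

variable {M} in
theorem cmk_sound {a b n n' : ℕ} {f : C.Hom a n} {g : C.Hom b n} {f' : C.Hom a n'}
    {g' : C.Hom b n'} (m : C.Hom n n') (hm : M (X := n) (Y := n') m) (hf : C.comp f m = f')
    (hg : C.comp g m = g') : cmk M f g = cmk M f' g' :=
  Quot.sound ⟨m, hm, hf, hg⟩

/-- The composite of two cospans, obtained from a pushout. -/
noncomputable def Cosp.comp [TensorPushouts C] {a b c : ℕ} (s : Cosp C a b) (t : Cosp C b c) :
    Cosp C a c :=
  haveI : HasPushouts C.Ob := TensorPushouts.hasPushouts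
  { apex := pushout (C := C.Ob) s.right t.left
    left := C.comp s.left (pushout.inl (C := C.Ob) s.right t.left)
    right := C.comp t.right (pushout.inr (C := C.Ob) s.right t.left) }

theorem exists_pushout [TensorPushouts C] {y n m : ℕ} (f : C.Hom y n) (g : C.Hom y m) :
    ∃ (p : ℕ) (i : C.Hom n p) (j : C.Hom m p), IsPushout (C := C.Ob) f g i j :=
  have : HasPushouts C.Ob := TensorPushouts.hasPushouts
  ⟨_, _, _, IsPushout.of_hasPushout (C := C.Ob) f g⟩

theorem eqArrow_cmk_left {a b : ℕ} (h : a = b) :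
    eqArrow (fun a => cmk M (C.id a) (C.id a)) h = cmk M (eqArrow C.id h) (C.id b) := by
  cases h; rfl

theorem eqArrow_cmk_right {a b : ℕ} (h : a = b) :
    eqArrow (fun a => cmk M (C.id a) (C.id a)) h = cmk M (C.id a) (eqArrow C.id h.symm) := by
  cases h; rfl

theorem cmk_eqArrow {a a' b b' n n' : ℕ} (ha : a = a') (hb : b = b') (hn : n = n')
    (f : C.Hom a n) (f' : C.Hom a' n') (g : C.Hom b n) (g' : C.Hom b' n')
    (hf : C.comp f (eqArrow C.id hn) = C.comp (eqArrow C.id ha) f')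
    (hg : C.comp g (eqArrow C.id hn) = C.comp (eqArrow C.id hb) g') :
    cmk M f (C.comp (eqArrow C.id hb.symm) g) = cmk M (C.comp (eqArrow C.id ha) f') g' := by
  cases ha; cases hb; cases hn
  simp only [eqArrow, C.comp_id, C.id_comp] at *
  rw [hf, hg]

variable [M.ContainsIdentities]

variable {M} in
theorem mem_id (a : ℕ) : M (X := a) (Y := a) (C.id a) := M.id_mem (X := a)

variable [M.IsStableUnderCobaseChange]

variable {M} in
theorem mem_of_inv {a b : ℕ} (f : C.Hom a b) (g : C.Hom b a) (h : C.comp f g = C.id a)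
    (h' : C.comp g f = C.id b) : M (X := a) (Y := b) f :=
  have : IsIso (C := C.Ob) (X := a) (Y := b) f := ⟨g, h, h'⟩
  M.of_isIso (X := a) (Y := b) f

theorem mk_comp [TensorPushouts C] {a b c p : ℕ} (s : Cosp C a b) (t : Cosp C b c)
    {i : C.Hom s.apex p} {j : C.Hom t.apex p} (h : IsPushout (C := C.Ob) s.right t.left i j) :
    (Quot.mk _ (s.comp t) : CospMod M a c) = cmk M (C.comp s.left i) (C.comp t.right j) := by
  have : HasPushouts C.Ob := TensorPushouts.hasPushouts
  have e1 := h.inl_isoPushout_inv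
  have e2 := h.inr_isoPushout_inv
  refine cmk_sound (M := M) h.isoPushout.inv (mem_of_inv h.isoPushout.inv h.isoPushout.hom
    h.isoPushout.inv_hom_id h.isoPushout.hom_inv_id) ?_ ?_
  · exact (C.assoc _ _ _).trans (congrArg (C.comp s.left) e1)
  · exact (C.assoc _ _ _).trans (congrArg (C.comp t.right) e2)

/-- Composition of classes of cospans. -/
noncomputable def ccomp [TensorPushouts C] {a b c : ℕ} :
    CospMod M a b → CospMod M b c → CospMod M a c :=
  Quot.lift₂ (fun s t => Quot.mk _ (s.comp t))
    (by
      rintro s t t' ⟨m, hm, hl, hr⟩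
      obtain ⟨p, i, j, h⟩ := exists_pushout s.right t.left
      obtain ⟨q, k, m', h'⟩ := exists_pushout j m
      have h2 : IsPushout (C := C.Ob) s.right t'.left (C.comp i k) m' := hl ▸ h.paste_vert h'
      rw [mk_comp M s t h, mk_comp M s t' h2]
      refine cmk_sound k (MorphismProperty.IsStableUnderCobaseChange.of_isPushout h' hm)
        (C.assoc _ _ _) ?_
      have e : C.comp j k = C.comp m m' := h'.w
      rw [C.assoc, e, ← hr, C.assoc])
    (by
      rintro s s' t ⟨m, hm, hl, hr⟩
      obtain ⟨p, i, j, h⟩ := exists_pushout s.right t.left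
      obtain ⟨q, k, m', h'⟩ := exists_pushout i m
      have h2 : IsPushout (C := C.Ob) s'.right t.left m' (C.comp j k) :=
        hr ▸ (h.flip.paste_vert h').flip
      rw [mk_comp M s t h, mk_comp M s' t h2]
      refine cmk_sound k (MorphismProperty.IsStableUnderCobaseChange.of_isPushout h' hm)
        ?_ (C.assoc _ _ _)
      have e : C.comp i k = C.comp m m' := h'.w
      rw [C.assoc, e, ← hl, C.assoc])

theorem ccomp_eq [TensorPushouts C] {a b c n n' p : ℕ} (f : C.Hom a n) (g : C.Hom b n)
    (f' : C.Hom b n') (g' : C.Hom c n') {i : C.Hom n p} {j : C.Hom n' p}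
    (h : IsPushout (C := C.Ob) g f' i j) :
    ccomp M (cmk M f g) (cmk M f' g') = cmk M (C.comp f i) (C.comp g' j) :=
  mk_comp M ⟨n, f, g⟩ ⟨n', f', g'⟩ h

theorem ccomp_left [TensorPushouts C] {a b c n : ℕ} (h : C.Hom a b) (f : C.Hom b n)
    (g : C.Hom c n) : ccomp M (cmk M h (C.id b)) (cmk M f g) = cmk M (C.comp h f) g := by
  rw [ccomp_eq M h (C.id b) f g (IsPushout.id_horiz (C := C.Ob) f)]
  exact congrArg _ (C.comp_id g)

theorem ccomp_right [TensorPushouts C] {a b c n : ℕ} (f : C.Hom a n) (g : C.Hom b n)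
    (h : C.Hom c b) : ccomp M (cmk M f g) (cmk M (C.id b) h) = cmk M f (C.comp h g) := by
  rw [ccomp_eq M f g (C.id b) h (IsPushout.id_vert (C := C.Ob) g)]
  exact congrArg (fun x => cmk M x _) (C.comp_id f)

/-- Monoidal product of classes of cospans. -/
def ctensor [TensorClosed M] {a b c d : ℕ} :
    CospMod M a b → CospMod M c d → CospMod M (a + c) (b + d) :=
  Quot.lift₂ (fun s t => cmk M (C.tensor s.left t.left) (C.tensor s.right t.right))
    (by
      rintro s t t' ⟨m, hm, hl, hr⟩
      refine cmk_sound (C.tensor (C.id _) m) (TensorClosed.tensor (mem_id _) hm) ?_ ?_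
      · rw [← C.tensor_comp, C.comp_id, hl]
      · rw [← C.tensor_comp, C.comp_id, hr])
    (by
      rintro s s' t ⟨m, hm, hl, hr⟩
      refine cmk_sound (C.tensor m (C.id _)) (TensorClosed.tensor hm (mem_id _)) ?_ ?_
      · rw [← C.tensor_comp, C.comp_id, hl]
      · rw [← C.tensor_comp, C.comp_id, hr])

theorem cmk_symm (a b : ℕ) :
    cmk M (C.symm a b) (C.id (b + a)) = cmk M (C.id (a + b)) (C.symm b a) :=
  cmk_sound (C.symm b a) (mem_of_inv _ _ (C.symm_symm b a) (C.symm_symm a b))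
    (C.symm_symm a b) (C.id_comp _)

/-- The prop of cospans in `C` modulo the equivalence relation generated by `CospRel M`, with
composition by pushout and with monoidal product and symmetries inherited from `C`. -/
noncomputable def cospMod [TensorPushouts C] [TensorClosed M] : PROP where
  Hom a b := CospMod M a b
  id a := cmk M (C.id a) (C.id a)
  comp := ccomp M
  id_comp := by
    rintro a b ⟨s⟩
    exact (ccomp_left M _ s.left s.right).trans (by rw [C.id_comp]; rfl)
  comp_id := by
    rintro a b ⟨s⟩
    exact (ccomp_right M s.left s.right _).trans (by rw [C.id_comp]; rfl)
  assoc := by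
    rintro a b c d ⟨⟨n, f, g⟩⟩ ⟨⟨n', f', g'⟩⟩ ⟨⟨n'', f'', g''⟩⟩
    obtain ⟨p, i, j, h⟩ := exists_pushout g f'
    obtain ⟨q, k, l, h'⟩ := exists_pushout g' f''
    obtain ⟨r, u, v, h''⟩ := exists_pushout j k
    change ccomp M (ccomp M (cmk M f g) (cmk M f' g')) (cmk M f'' g'') =
      ccomp M (cmk M f g) (ccomp M (cmk M f' g') (cmk M f'' g''))
    have h1 : IsPushout (C := C.Ob) (C.comp g' j) f'' u (C.comp l v) :=
      (h'.flip.paste_vert h''.flip).flip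
    have h2 : IsPushout (C := C.Ob) g (C.comp f' k) (C.comp i u) v := h.paste_vert h''
    rw [ccomp_eq M f g f' g' h, ccomp_eq M f' g' f'' g'' h',
      ccomp_eq M (C.comp f i) (C.comp g' j) f'' g'' h1,
      ccomp_eq M f g (C.comp f' k) (C.comp g'' l) h2, C.assoc, C.assoc]
  tensor := ctensor M
  tensor_id a b := by
    change cmk M (C.tensor _ _) (C.tensor _ _) = _
    rw [C.tensor_id]
  tensor_comp := by
    rintro a b c a' b' c' ⟨⟨n, f, g⟩⟩ ⟨⟨m, h, k⟩⟩ ⟨⟨n', f', g'⟩⟩ ⟨⟨m', h', k'⟩⟩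
    obtain ⟨p, i, j, e⟩ := exists_pushout g h
    obtain ⟨p', i', j', e'⟩ := exists_pushout g' h'
    change ctensor M (ccomp M (cmk M f g) (cmk M h k)) (ccomp M (cmk M f' g') (cmk M h' k')) =
      ccomp M (cmk M (C.tensor f f') (C.tensor g g')) (cmk M (C.tensor h h') (C.tensor k k'))
    rw [ccomp_eq M f g h k e, ccomp_eq M f' g' h' k' e',
      ccomp_eq M _ _ _ _ (TensorPushouts.tensor e e'), ← C.tensor_comp, ← C.tensor_comp]
    rfl
  tensor_assoc := by
    rintro a b a' b' a'' b'' ⟨⟨n, f, g⟩⟩ ⟨⟨n', f', g'⟩⟩ ⟨⟨n'', f'', g''⟩⟩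
    refine (congrArg (ccomp M _) (eqArrow_cmk_right M _)).trans ((ccomp_right M _ _ _).trans
      (Eq.trans ?_ ((congrArg (fun x => ccomp M x _) (eqArrow_cmk_left M _)).trans
        (ccomp_left M _ _ _)).symm))
    exact cmk_eqArrow M _ _ _ _ _ _ _ (C.tensor_assoc f f' f'') (C.tensor_assoc g g' g'')
  unit_tensor := by
    rintro a b ⟨⟨n, f, g⟩⟩
    refine (congrArg (ccomp M _) (eqArrow_cmk_right M _)).trans ((ccomp_right M _ _ _).trans
      (Eq.trans ?_ ((congrArg (fun x => ccomp M x _) (eqArrow_cmk_left M _)).trans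
        (ccomp_left M _ f g)).symm))
    exact cmk_eqArrow M _ _ _ _ _ _ _ (C.unit_tensor f) (C.unit_tensor g)
  tensor_unit := by
    rintro a b ⟨⟨n, f, g⟩⟩
    refine (congrArg (ccomp M _) (eqArrow_cmk_right M _)).trans ((ccomp_right M _ _ _).trans
      (Eq.trans ?_ ((congrArg (fun x => ccomp M x _) (eqArrow_cmk_left M _)).trans
        (ccomp_left M _ f g)).symm))
    exact cmk_eqArrow M _ _ _ _ _ _ _ (C.tensor_unit f) (C.tensor_unit g)
  symm a b := cmk M (C.symm a b) (C.id (b + a))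
  symm_natural := by
    rintro a b a' b' ⟨⟨n, f, g⟩⟩ ⟨⟨n', f', g'⟩⟩
    refine (congrArg (ccomp M _) (cmk_symm M b b')).trans ((ccomp_right M _ _ _).trans
      (Eq.trans ?_ (ccomp_left M _ _ _).symm))
    refine cmk_sound (C.symm n n') (mem_of_inv _ _ (C.symm_symm n n') (C.symm_symm n' n))
      (C.symm_natural f f') ?_
    change C.comp (C.comp (C.symm b' b) (C.tensor g g')) (C.symm n n') = C.tensor g' g
    rw [C.assoc, C.symm_natural, ← C.assoc, C.symm_symm, C.id_comp]
  symm_symm a b := by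
    rw [ccomp_left M, C.symm_symm]
  hexagon a b c := by
    simp only [eqArrow_cmk_left]
    have e := C.hexagon a b c
    change _ = ccomp M (ccomp M (cmk M (C.tensor _ _) (C.tensor _ _)) _)
      (cmk M (C.tensor _ _) (C.tensor _ _))
    simp only [ccomp_left, C.tensor_id]
    rw [← e]

/-- The inclusion of `C`, sending `f` to the class of the cospan with legs `f` and `id`. -/
noncomputable def modOf [TensorPushouts C] [TensorClosed M] : C ⟶ cospMod M :=
  Mor.mk (P := C) (Q := cospMod M) (fun {_ b} f => cmk M f (C.id b)) (fun _ => rfl)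
    (fun f g => (ccomp_left M f g (C.id _)).symm)
    (fun f g => by
      change _ = cmk M (C.tensor _ _) (C.tensor _ _)
      rw [C.tensor_id])
    (fun _ _ => rfl)

/-- The inclusion of the opposite of `C`, sending `g` to the class of the cospan with legs `id`
and `g`. -/
noncomputable def modOfOp [TensorPushouts C] [TensorClosed M] : C.op ⟶ cospMod M :=
  Mor.mk (P := C.op) (Q := cospMod M) (fun {a _} g => cmk M (C.id a) g) (fun _ => rfl)
    (fun {a b c} f g => (ccomp_right M (C.id a) (show C.Hom b a from f) g).symm)
    (fun f g => by
      change _ = cmk M (C.tensor _ _) (C.tensor _ _)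
      rw [C.tensor_id]; rfl)
    (fun a b => (cmk_symm M a b).symm)

end CospMod

instance (C : PROP) : TensorClosed (MorphismProperty.isomorphisms C.Ob) where
  tensor := by
    rintro a b c d f g ⟨f', h1, h2⟩ ⟨g', h3, h4⟩
    exact ⟨C.tensor (a := b) (b := a) (c := d) (d := c) f' g', C.tensor_inv h1 h3,
      C.tensor_inv h2 h4⟩

/-- The prop of cospans in `C`: arrows are isomorphism classes of cospans, i.e. classes of cospans
modulo isomorphisms between the apexes. -/
noncomputable def Cospan (C : PROP) [TensorPushouts C] : PROP :=
  cospMod (MorphismProperty.isomorphisms C.Ob)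

/-- The prop of spans in `A`, i.e. of cospans in the opposite of `A`: an arrow `a ⟶ b` is an
isomorphism class of spans `a ⟵ n ⟶ b` in `A`, and composition is by pullback in `A`. -/
noncomputable abbrev Span (A : PROP) [TensorPushouts A.op] : PROP := Cospan A.op

/-- The isomorphism class of the cospan `a ⟶ n ⟵ b` with legs `f` and `g`. -/
def Cospan.mk {C : PROP} [TensorPushouts C] {a b n : ℕ} (f : C.Hom a n) (g : C.Hom b n) :
    (Cospan C).Hom a b :=
  cmk (MorphismProperty.isomorphisms C.Ob) f g

/-- The isomorphism class of the span `a ⟵ n ⟶ b` with legs `f` and `g`. -/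
def Span.mk {A : PROP} [TensorPushouts A.op] {a b n : ℕ} (f : A.Hom n a) (g : A.Hom n b) :
    (Span A).Hom a b :=
  Cospan.mk (C := A.op) f g

/-- The morphism `C ⟶ Cospan C` sending `f` to the cospan with legs `f` and `id`. -/
noncomputable def cospanOf (C : PROP) [TensorPushouts C] : C ⟶ Cospan C := modOf _

/-- The morphism `C.op ⟶ Cospan C` sending `g` to the cospan with legs `id` and `g`. -/
noncomputable def cospanOfOp (C : PROP) [TensorPushouts C] : C.op ⟶ Cospan C := modOfOp _

/-- The morphism `A ⟶ Span A` sending `f` to the span with legs `id` and `f`. -/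
noncomputable def spanOf (A : PROP) [TensorPushouts A.op] : A ⟶ Span A := cospanOfOp A.op

/-- The morphism `A.op ⟶ Span A` sending `g` to the span with legs `g` and `id`. -/
noncomputable def spanOfOp (A : PROP) [TensorPushouts A.op] : A.op ⟶ Span A := cospanOf A.op

end PROP

/-- A costable factorisation system `(E, M)`: the classes `E` and `M` are subcategories containing
all isomorphisms, each arrow factors as an arrow of `E` followed by an arrow of `M`, these
factorisations are functorial in a unique way, and `M` is stable under pushout. -/
structure CostableFactorisation (X : Type) [Category.{0} X] where
  E : MorphismProperty X
  M : MorphismProperty X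
  E_mul : E.IsMultiplicative
  M_mul : M.IsMultiplicative
  E_iso {x y : X} (f : x ⟶ y) : IsIso f → E f
  M_iso {x y : X} (f : x ⟶ y) : IsIso f → M f
  fac {x y : X} (f : x ⟶ y) : ∃ (z : X) (e : x ⟶ z) (m : z ⟶ y), E e ∧ M m ∧ e ≫ m = f
  diag {x z y x' z' y' : X} (e : x ⟶ z) (m : z ⟶ y) (e' : x' ⟶ z') (m' : z' ⟶ y')
    (u : x ⟶ x') (v : y ⟶ y') : E e → M m → E e' → M m' → (e ≫ m) ≫ v = u ≫ e' ≫ m' →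
      ∃! s : z ⟶ z', e ≫ s = u ≫ e' ∧ m ≫ v = s ≫ m'
  M_costable : M.IsStableUnderCobaseChange

namespace PROP

instance {X : Type} [Category.{0} X] (F : CostableFactorisation X) :
    F.M.IsStableUnderCobaseChange := F.M_costable

instance {X : Type} [Category.{0} X] (F : CostableFactorisation X) :
    F.M.ContainsIdentities := F.M_mul.toContainsIdentities

/-- The prop of corelations in `C` with respect to a costable factorisation system `(E, M)` such
that `M` is closed under the monoidal product: arrows are classes of cospans modulo the equivalence
relation generated by the arrows of `M` between the apexes. -/
noncomputable def Corel (C : PROP) [TensorPushouts C] (F : CostableFactorisation C.Ob)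
    [TensorClosed F.M] : PROP :=
  cospMod F.M

/-- The corelation represented by the cospan `a ⟶ n ⟵ b` with legs `f` and `g`. -/
def Corel.mk {C : PROP} [TensorPushouts C] (F : CostableFactorisation C.Ob) [TensorClosed F.M]
    {a b n : ℕ} (f : C.Hom a n) (g : C.Hom b n) : (Corel C F).Hom a b :=
  cmk F.M f g

/-- The morphism of props sending a cospan to the corelation it represents. -/
noncomputable def toCorel (C : PROP) [TensorPushouts C] (F : CostableFactorisation C.Ob)
    [TensorClosed F.M] : Cospan C ⟶ Corel C F :=
  Mor.mk (P := Cospan C) (Q := Corel C F)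
    (Quot.lift (fun s => Corel.mk F s.left s.right)
      (fun _ _ ⟨m, hm, hl, hr⟩ => cmk_sound m (F.M_iso _ hm) hl hr))
    (fun _ => rfl)
    (by
      rintro a b c ⟨⟨n, f, g⟩⟩ ⟨⟨n', f', g'⟩⟩
      obtain ⟨p, i, j, h⟩ := exists_pushout g f'
      refine Eq.trans (congrArg _ (ccomp_eq _ f g f' g' h)) (ccomp_eq F.M f g f' g' h).symm)
    (by rintro a b c d ⟨s⟩ ⟨t⟩; rfl)
    (fun _ _ => rfl)

end PROP

namespace PROP

/-- A prop structure induced along an injective family of maps into a prop. -/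
def ofFaithful (P : PROP) (H : ℕ → ℕ → Type) (φ : ∀ {a b : ℕ}, H a b → P.Hom a b)
    (inj : ∀ {a b : ℕ} (f g : H a b), φ f = φ g → f = g)
    (id : ∀ a, H a a) (comp : ∀ {a b c : ℕ}, H a b → H b c → H a c)
    (tensor : ∀ {a b c d : ℕ}, H a b → H c d → H (a + c) (b + d))
    (symm : ∀ a b, H (a + b) (b + a))
    (h_id : ∀ a, φ (id a) = P.id a)
    (h_comp : ∀ {a b c : ℕ} (f : H a b) (g : H b c), φ (comp f g) = P.comp (φ f) (φ g))
    (h_tensor : ∀ {a b c d : ℕ} (f : H a b) (g : H c d),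
      φ (tensor f g) = P.tensor (φ f) (φ g))
    (h_symm : ∀ a b, φ (symm a b) = P.symm a b) : PROP :=
  have h_eq : ∀ {a b : ℕ} (h : a = b), φ (eqArrow id h) = eqArrow P.id h := by
    rintro a b rfl; exact h_id a
  { Hom := H
    id := id
    comp := comp
    id_comp := fun f => inj _ _ (by rw [h_comp, h_id, P.id_comp])
    comp_id := fun f => inj _ _ (by rw [h_comp, h_id, P.comp_id])
    assoc := fun f g h => inj _ _ (by simp only [h_comp, P.assoc])
    tensor := tensor
    tensor_id := fun a b => inj _ _ (by simp only [h_tensor, h_id, P.tensor_id])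
    tensor_comp := fun f g f' g' => inj _ _ (by simp only [h_tensor, h_comp, P.tensor_comp])
    tensor_assoc := fun f g h => inj _ _ (by
      simp only [h_tensor, h_comp, h_eq, P.tensor_assoc])
    unit_tensor := fun f => inj _ _ (by simp only [h_tensor, h_comp, h_eq, h_id, P.unit_tensor])
    tensor_unit := fun f => inj _ _ (by simp only [h_tensor, h_comp, h_eq, h_id, P.tensor_unit])
    symm := symm
    symm_natural := fun f g => inj _ _ (by
      simp only [h_tensor, h_comp, h_symm, P.symm_natural])
    symm_symm := fun a b => inj _ _ (by simp only [h_comp, h_symm, h_id, P.symm_symm])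
    hexagon := fun a b c => inj _ _ (by
      simp only [h_tensor, h_comp, h_symm, h_id, h_eq, P.hexagon]) }

/-! ### Partial functions and injections -/

/-- The monoidal product of two partial functions. -/
def pfTensor {a b c d : ℕ} (f : Fin a → Option (Fin b)) (g : Fin c → Option (Fin d)) :
    Fin (a + c) → Option (Fin (b + d)) :=
  Fin.addCases (fun i => (f i).map (Fin.castAdd d)) (fun j => (g j).map (Fin.natAdd b))

/-- The block permutation. -/
def swapFin (a b : ℕ) : Fin (a + b) → Fin (b + a) :=
  Fin.addCases (Fin.natAdd b) (Fin.castAdd a)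

theorem eqArrow_pf {a b : ℕ} (h : a = b) :
    eqArrow (H := fun a b => Fin a → Option (Fin b)) (fun _ => some) h
      = fun i => some (Fin.cast h i) := by
  cases h; rfl

@[simp] theorem pfTensor_castAdd {a b c d : ℕ} (f : Fin a → Option (Fin b))
    (g : Fin c → Option (Fin d)) (i : Fin a) :
    pfTensor f g (Fin.castAdd c i) = (f i).map (Fin.castAdd d) := by
  simp [pfTensor]

@[simp] theorem pfTensor_natAdd {a b c d : ℕ} (f : Fin a → Option (Fin b))
    (g : Fin c → Option (Fin d)) (i : Fin c) :
    pfTensor f g (Fin.natAdd a i) = (g i).map (Fin.natAdd b) := by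
  simp [pfTensor]

@[simp] theorem swapFin_castAdd (a b : ℕ) (i : Fin a) :
    swapFin a b (Fin.castAdd b i) = Fin.natAdd b i := by simp [swapFin]

@[simp] theorem swapFin_natAdd (a b : ℕ) (i : Fin b) :
    swapFin a b (Fin.natAdd a i) = Fin.castAdd a i := by simp [swapFin]

@[elab_as_elim] theorem fin_cases_add {a b : ℕ} {motive : Fin (a + b) → Prop} (i : Fin (a + b))
    (h : ∀ i, motive (Fin.castAdd b i)) (h' : ∀ i, motive (Fin.natAdd a i)) : motive i :=
  Fin.addCases h h' i

/-- The prop of partial functions: an arrow `a ⟶ b` is a partial function from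
`{0, …, a - 1}` to `{0, …, b - 1}`, and the monoidal product is the disjoint union. -/
def PF : PROP where
  Hom a b := Fin a → Option (Fin b)
  id _ := some
  comp f g := fun i => (f i).bind g
  id_comp f := by funext i; rfl
  comp_id f := by funext i; simp
  assoc f g h := by funext i; simp [Option.bind_assoc]
  tensor f g := pfTensor f g
  tensor_id a b := by
    funext i; refine fin_cases_add i (fun i => ?_) (fun i => ?_) <;> simp
  tensor_comp {a b c a' b' c'} f g f' g' := by
    funext i
    refine fin_cases_add i (fun i => ?_) (fun i => ?_)
    · simp only [pfTensor_castAdd]; cases f i <;> simp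
    · simp only [pfTensor_natAdd]; cases f' i <;> simp
  tensor_assoc {a b a' b' a'' b''} f g h := by
    funext i
    simp only [eqArrow_pf]
    refine fin_cases_add i (fun i => ?_) (fun i => ?_)
    · refine fin_cases_add i (fun i => ?_) (fun i => ?_)
      · have e : Fin.cast (Nat.add_assoc a a' a'') (Fin.castAdd a'' (Fin.castAdd a' i))
            = Fin.castAdd _ i := by ext; simp
        simp only [pfTensor_castAdd, Option.bind_some, e]; cases f i <;> simp; ext; simp
      · have e : Fin.cast (Nat.add_assoc a a' a'') (Fin.castAdd a'' (Fin.natAdd a i))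
            = Fin.natAdd _ (Fin.castAdd _ i) := by ext; simp
        simp only [pfTensor_castAdd, pfTensor_natAdd, Option.bind_some, e]
        cases g i <;> simp; ext; simp
    · have e : Fin.cast (Nat.add_assoc a a' a'') (Fin.natAdd (a + a') i)
          = Fin.natAdd _ (Fin.natAdd _ i) := by ext; simp [Nat.add_assoc]
      simp only [pfTensor_natAdd, Option.bind_some, e]
      cases h i <;> simp; ext; simp [Nat.add_assoc]
  unit_tensor {a b} f := by
    funext i
    simp only [eqArrow_pf]
    refine fin_cases_add i (fun i => i.elim0) (fun i => ?_)
    have e : Fin.cast (Nat.zero_add a) (Fin.natAdd 0 i) = i := by ext; simp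
    simp only [pfTensor_natAdd, Option.bind_some, e]
    cases f i <;> simp
  tensor_unit {a b} f := by
    funext i
    simp only [eqArrow_pf]
    refine fin_cases_add i (fun i => ?_) (fun i => i.elim0)
    simp only [pfTensor_castAdd, Option.bind_some]
    have e : Fin.cast (Nat.add_zero a) (Fin.castAdd 0 i) = i := by ext; simp
    rw [e]
    cases f i <;> simp
  symm a b := fun i => some (swapFin a b i)
  symm_natural f g := by
    funext i
    refine fin_cases_add i (fun i => ?_) (fun i => ?_)
    · simp only [pfTensor_castAdd, swapFin_castAdd, Option.bind_some, pfTensor_natAdd]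
      cases f i <;> simp
    · simp only [pfTensor_castAdd, swapFin_natAdd, Option.bind_some, pfTensor_natAdd]
      cases g i <;> simp
  symm_symm a b := by
    funext i
    refine fin_cases_add i (fun i => ?_) (fun i => ?_) <;> simp
  hexagon a b c := by
    funext i
    simp only [eqArrow_pf]
    refine fin_cases_add i (fun i => ?_) (fun i => ?_)
    · refine fin_cases_add i (fun i => ?_) (fun i => ?_)
      · have e : Fin.cast (Nat.add_assoc a b c) (Fin.castAdd c (Fin.castAdd b i))
            = Fin.castAdd _ i := by ext; simp
        have e' : Fin.cast (Nat.add_assoc b a c) (Fin.castAdd c (Fin.natAdd b i))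
            = Fin.natAdd _ (Fin.castAdd _ i) := by ext; simp
        simp [e, e']; ext; simp [Nat.add_assoc]
      · have e : Fin.cast (Nat.add_assoc a b c) (Fin.castAdd c (Fin.natAdd a i))
            = Fin.natAdd _ (Fin.castAdd _ i) := by ext; simp
        have e' : Fin.cast (Nat.add_assoc b a c) (Fin.castAdd c (Fin.castAdd a i))
            = Fin.castAdd _ i := by ext; simp
        simp [e, e']; ext; simp
    · have e : Fin.cast (Nat.add_assoc a b c) (Fin.natAdd (a + b) i)
          = Fin.natAdd _ (Fin.natAdd _ i) := by ext; simp [Nat.add_assoc]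
      have e' : Fin.cast (Nat.add_assoc b a c) (Fin.natAdd (b + a) i)
          = Fin.natAdd _ (Fin.natAdd _ i) := by ext; simp [Nat.add_assoc]
      simp [e, e']; ext; simp

/-- The disjoint union of two injections. -/
def injTensor {a b c d : ℕ} (f : Fin a ↪ Fin b) (g : Fin c ↪ Fin d) :
    Fin (a + c) ↪ Fin (b + d) where
  toFun := Fin.addCases (fun i => Fin.castAdd d (f i)) (fun j => Fin.natAdd b (g j))
  inj' := by
    intro i j
    refine fin_cases_add i (fun i => ?_) (fun i => ?_) <;>
      refine fin_cases_add j (fun j => ?_) (fun j => ?_) <;> intro h <;>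
      simp [Fin.ext_iff] at h ⊢
    · exact congrArg Fin.val (f.injective (Fin.ext h))
    · have := (f i).isLt; omega
    · have := (f j).isLt; omega
    · exact congrArg Fin.val (g.injective (Fin.ext h))

@[simp] theorem injTensor_castAdd {a b c d : ℕ} (f : Fin a ↪ Fin b) (g : Fin c ↪ Fin d)
    (i : Fin a) : injTensor f g (Fin.castAdd c i) = Fin.castAdd d (f i) := by
  change Fin.addCases (motive := fun _ => Fin (b + d)) (fun i => Fin.castAdd d (f i))
    (fun j => Fin.natAdd b (g j)) (Fin.castAdd c i) = _
  simp

@[simp] theorem injTensor_natAdd {a b c d : ℕ} (f : Fin a ↪ Fin b) (g : Fin c ↪ Fin d)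
    (i : Fin c) : injTensor f g (Fin.natAdd a i) = Fin.natAdd b (g i) := by
  change Fin.addCases (motive := fun _ => Fin (b + d)) (fun i => Fin.castAdd d (f i))
    (fun j => Fin.natAdd b (g j)) (Fin.natAdd a i) = _
  simp

theorem pfTensor_inj {a b c d : ℕ} (f : Fin a ↪ Fin b) (g : Fin c ↪ Fin d) :
    (fun i => some (injTensor f g i)) = pfTensor (fun i => some (f i)) (fun i => some (g i)) := by
  funext i
  refine fin_cases_add i (fun i => ?_) (fun i => ?_) <;> simp

/-- The block permutation, as an injection. -/
def injSwap (a b : ℕ) : Fin (a + b) ↪ Fin (b + a) where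
  toFun := swapFin a b
  inj' := Function.LeftInverse.injective (g := swapFin b a) (fun i => by
    refine fin_cases_add i (fun i => ?_) (fun i => ?_) <;> simp)

/-- The prop of injections: an arrow `a ⟶ b` is an injection from `{0, …, a - 1}` to
`{0, …, b - 1}`, and the monoidal product is the disjoint union. -/
def Inj : PROP :=
  ofFaithful PF (fun a b => Fin a ↪ Fin b) (fun f i => some (f i))
    (fun f g h => by ext i; exact congrArg Fin.val (Option.some.inj (congrFun h i)))
    (fun a => Function.Embedding.refl (Fin a)) (fun f g => f.trans g) injTensor injSwap
    (fun _ => rfl) (fun _ _ => rfl)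
    pfTensor_inj
    (fun _ _ => rfl)

/-- The inclusion of injections into partial functions. -/
def injPF : Inj ⟶ PF :=
  Mor.mk (P := Inj) (Q := PF) (fun {a b} (f : Fin a ↪ Fin b) i => some (f i))
    (fun _ => rfl) (fun _ _ => rfl)
    pfTensor_inj
    (fun _ _ => rfl)

end PROP

namespace PROP

/-! ### Pushouts of partial functions, pullbacks of injections -/

theorem PF.exists_isPushout {y n m : ℕ} (f : PF.Hom y n) (g : PF.Hom y m) :
    ∃ (p : ℕ) (i : PF.Hom n p) (j : PF.Hom m p), IsPushout (C := PF.Ob) f g i j := by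
  classical
  let r : Option (Fin n ⊕ Fin m) → Option (Fin n ⊕ Fin m) → Prop := fun u v =>
    ∃ k : Fin y, u = (f k).map Sum.inl ∧ v = (g k).map Sum.inr
  let S := {w : Quot r // w ≠ Quot.mk r none}
  have : Finite (Quot r) := Finite.of_surjective (Quot.mk r) Quot.mk_surjective
  obtain ⟨p, ⟨e⟩⟩ := Finite.exists_equiv_fin S
  let c : Quot r → Option (Fin p) := fun w => if h : w = Quot.mk r none then none else some (e ⟨w, h⟩)
  have c0 : c (Quot.mk r none) = none := dif_pos rfl
  have c1 : ∀ k : Fin p, c (e.symm k).1 = some k := fun k => by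
    simp only [c, dif_neg (e.symm k).2]; simp
  have c2 : ∀ {T : Type} (D : Quot r → Option T), D (Quot.mk r none) = none →
      ∀ w, (c w).bind (fun k => D (e.symm k).1) = D w := by
    intro T D hD w
    by_cases h : w = Quot.mk r none
    · subst h; rw [c0, hD]; rfl
    · simp [c, dif_neg h]
  refine ⟨p, fun x => c (Quot.mk r (some (Sum.inl x))), fun x => c (Quot.mk r (some (Sum.inr x))),
    IsPushout.mk' ?_ ?_ ?_⟩
  · funext k
    have h1 : (f k).bind (fun x => c (Quot.mk r (some (Sum.inl x)))) =
        c (Quot.mk r ((f k).map Sum.inl)) := by cases f k <;> simp [c0]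
    have h2 : (g k).bind (fun x => c (Quot.mk r (some (Sum.inr x)))) =
        c (Quot.mk r ((g k).map Sum.inr)) := by cases g k <;> simp [c0]
    exact h1.trans ((congrArg c (Quot.sound ⟨k, rfl, rfl⟩)).trans h2.symm)
  · intro T φ ψ h1 h2
    funext k
    have key : ∀ w, c w = some k → φ k = ψ k := by
      rintro ⟨o⟩ hw
      rcases o with _ | x | x
      · rw [c0] at hw; cases hw
      · have := congrFun h1 x
        change (c _).bind φ = (c _).bind ψ at this
        rwa [hw] at this
      · have := congrFun h2 x
        change (c _).bind φ = (c _).bind ψ at this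
        rwa [hw] at this
    exact key _ (c1 k)
  · intro T a b hab
    let D : Quot r → Option (Fin T) := Quot.lift (fun o => o.bind (Sum.elim a b)) (by
      rintro _ _ ⟨k, rfl, rfl⟩
      have := congrFun hab k
      change (f k).bind a = (g k).bind b at this
      cases hf : f k <;> cases hg : g k <;> simp [hf, hg] at this ⊢ <;> exact this)
    exact ⟨fun k => D (e.symm k).1, funext fun x => c2 D rfl _, funext fun x => c2 D rfl _⟩

/-- Partial functions on a disjoint union are determined on the summands. -/
theorem PF.ext_add {a b c : ℕ} {φ ψ : PF.Hom (a + b) c}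
    (h : ∀ i, φ (Fin.castAdd b i) = ψ (Fin.castAdd b i))
    (h' : ∀ i, φ (Fin.natAdd a i) = ψ (Fin.natAdd a i)) : φ = ψ := by
  funext i; exact fin_cases_add i h h'

theorem pfTensor_bind_castAdd {a b c d t : ℕ} (u : Fin a → Option (Fin b))
    (v : Fin c → Option (Fin d)) (w : Fin (b + d) → Option (Fin t)) (x : Fin a) :
    (pfTensor u v (Fin.castAdd c x)).bind w = (u x).bind fun k => w (Fin.castAdd d k) := by
  rw [pfTensor_castAdd]; cases u x <;> rfl

theorem pfTensor_bind_natAdd {a b c d t : ℕ} (u : Fin a → Option (Fin b))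
    (v : Fin c → Option (Fin d)) (w : Fin (b + d) → Option (Fin t)) (x : Fin c) :
    (pfTensor u v (Fin.natAdd a x)).bind w = (v x).bind fun k => w (Fin.natAdd b k) := by
  rw [pfTensor_natAdd]; cases v x <;> rfl

instance : TensorPushouts PF where
  hasPushouts :=
    have (y n m : PF.Ob) (f : y ⟶ n) (g : y ⟶ m) : HasColimit (span f g) := by
      obtain ⟨p, i, j, h⟩ := PF.exists_isPushout f g
      exact h.hasPushout
    hasPushouts_of_hasColimit_span _
  tensor {y n m p y' n' m' p' f g i j f' g' i' j'} h h' := by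
    have hw : PF.comp f i = PF.comp g j := h.w
    have hw' : PF.comp f' i' = PF.comp g' j' := h'.w
    have ev1 := fun {a b c d t : ℕ} (u : PF.Hom a b) (v : PF.Hom c d) (w : PF.Hom (b + d) t) x =>
      pfTensor_bind_castAdd u v w x
    have ev2 := fun {a b c d t : ℕ} (u : PF.Hom a b) (v : PF.Hom c d) (w : PF.Hom (b + d) t) x =>
      pfTensor_bind_natAdd u v w x
    refine IsPushout.mk' ?_ ?_ ?_
    · change PF.comp (PF.tensor f f') (PF.tensor i i') = PF.comp (PF.tensor g g') (PF.tensor j j')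
      rw [← PF.tensor_comp, ← PF.tensor_comp, hw, hw']
    · intro T φ ψ h1 h2
      refine PF.ext_add (fun k => ?_) (fun k => ?_)
      · refine congrFun (h.hom_ext (W := T) (k := fun k => φ (Fin.castAdd p' k))
          (l := fun k => ψ (Fin.castAdd p' k)) ?_ ?_) k
        · exact funext fun x => (ev1 i i' φ x).symm.trans ((congrFun h1 _).trans (ev1 i i' ψ x))
        · exact funext fun x => (ev1 j j' φ x).symm.trans ((congrFun h2 _).trans (ev1 j j' ψ x))
      · refine congrFun (h'.hom_ext (W := T) (k := fun k => φ (Fin.natAdd p k))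
          (l := fun k => ψ (Fin.natAdd p k)) ?_ ?_) k
        · exact funext fun x => (ev2 i i' φ x).symm.trans ((congrFun h1 _).trans (ev2 i i' ψ x))
        · exact funext fun x => (ev2 j j' φ x).symm.trans ((congrFun h2 _).trans (ev2 j j' ψ x))
    · intro T a b hab
      obtain ⟨u, hu1, hu2⟩ := h.exists_desc (W := T) (fun k => a (Fin.castAdd n' k))
        (fun k => b (Fin.castAdd m' k))
        (funext fun x => (ev1 f f' a x).symm.trans ((congrFun hab _).trans (ev1 g g' b x)))
      obtain ⟨v, hv1, hv2⟩ := h'.exists_desc (W := T) (fun k => a (Fin.natAdd n k))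
        (fun k => b (Fin.natAdd m k))
        (funext fun x => (ev2 f f' a x).symm.trans ((congrFun hab _).trans (ev2 g g' b x)))
      let w : PF.Hom (p + p') T := Fin.addCases u v
      have w1 : (fun k => w (Fin.castAdd p' k)) = u := funext fun k => Fin.addCases_left k
      have w2 : (fun k => w (Fin.natAdd p k)) = v := funext fun k => Fin.addCases_right k
      refine ⟨w, PF.ext_add (fun k => ?_) (fun k => ?_), PF.ext_add (fun k => ?_) (fun k => ?_)⟩
      · exact (ev1 i i' w k).trans (by rw [w1]; exact congrFun hu1 k)
      · exact (ev2 i i' w k).trans (by rw [w2]; exact congrFun hv1 k)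
      · exact (ev1 j j' w k).trans (by rw [w1]; exact congrFun hu2 k)
      · exact (ev2 j j' w k).trans (by rw [w2]; exact congrFun hv2 k)

/-- Pullback squares of injections. -/
theorem Inj.isPushout_op_iff {y n m p : ℕ} (f : Fin n ↪ Fin y) (g : Fin m ↪ Fin y) (i : Fin p ↪ Fin n)
    (j : Fin p ↪ Fin m) :
    IsPushout (C := Inj.op.Ob) (Z := y) (X := n) (Y := m) (P := p) f g i j ↔
      (∀ k, f (i k) = g (j k)) ∧ ∀ x x', f x = g x' → ∃ k, i k = x ∧ j k = x' := by
  constructor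
  · intro h
    refine ⟨fun k => DFunLike.congr_fun (F := Fin p ↪ Fin y) h.w k, fun x x' e => ?_⟩
    let a : Fin 1 ↪ Fin n := ⟨fun _ => x, fun _ _ _ => Subsingleton.elim _ _⟩
    let b : Fin 1 ↪ Fin m := ⟨fun _ => x', fun _ _ _ => Subsingleton.elim _ _⟩
    obtain ⟨d, h1, h2⟩ := h.exists_desc (W := (1 : ℕ)) a b
      (DFunLike.ext (F := Fin 1 ↪ Fin y) _ _ fun _ => e)
    exact ⟨(show Fin 1 ↪ Fin p from d) 0, DFunLike.congr_fun (F := Fin 1 ↪ Fin n) h1 0,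
      DFunLike.congr_fun (F := Fin 1 ↪ Fin m) h2 0⟩
  · rintro ⟨hw, hu⟩
    refine IsPushout.mk' (DFunLike.ext (F := Fin p ↪ Fin y) _ _ hw) ?_ ?_
    · intro (T : ℕ) (φ : Fin T ↪ Fin p) (ψ : Fin T ↪ Fin p) h1 h2
      refine DFunLike.ext (F := Fin T ↪ Fin p) _ _ fun k => i.injective ?_
      exact DFunLike.congr_fun (F := Fin T ↪ Fin n) h1 k
    · intro (T : ℕ) (a : Fin T ↪ Fin n) (b : Fin T ↪ Fin m) hab
      have hab' : ∀ k, f (a k) = g (b k) := fun k => DFunLike.congr_fun (F := Fin T ↪ Fin y) hab k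
      choose d h1 h2 using fun k => hu (a k) (b k) (hab' k)
      refine ⟨(⟨d, fun k k' e => a.injective ?_⟩ : Fin T ↪ Fin p),
        DFunLike.ext (F := Fin T ↪ Fin n) _ _ h1, DFunLike.ext (F := Fin T ↪ Fin m) _ _ h2⟩
      rw [← h1, ← h1, e]

theorem injTensor_square {y n m p y' n' m' p' : ℕ} {f : Fin n ↪ Fin y} {g : Fin m ↪ Fin y}
    {i : Fin p ↪ Fin n} {j : Fin p ↪ Fin m} {f' : Fin n' ↪ Fin y'} {g' : Fin m' ↪ Fin y'}
    {i' : Fin p' ↪ Fin n'} {j' : Fin p' ↪ Fin m'}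
    (h1 : ∀ k, f (i k) = g (j k)) (h2 : ∀ x x', f x = g x' → ∃ k, i k = x ∧ j k = x')
    (h1' : ∀ k, f' (i' k) = g' (j' k))
    (h2' : ∀ x x', f' x = g' x' → ∃ k, i' k = x ∧ j' k = x') :
    (∀ k, injTensor f f' (injTensor i i' k) = injTensor g g' (injTensor j j' k)) ∧
      ∀ x x', injTensor f f' x = injTensor g g' x' →
        ∃ k, injTensor i i' k = x ∧ injTensor j j' k = x' := by
  refine ⟨fun k => ?_, fun x x' => ?_⟩
  · refine fin_cases_add k (fun k => ?_) (fun k => ?_) <;> simp [h1, h1']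
  · refine fin_cases_add x (fun x => ?_) (fun x => ?_) <;>
      refine fin_cases_add x' (fun x' => ?_) (fun x' => ?_) <;>
      simp only [injTensor_castAdd, injTensor_natAdd] <;> intro e
    · obtain ⟨k, hk, hk'⟩ := h2 x x' (Fin.castAdd_injective _ _ e)
      exact ⟨Fin.castAdd p' k, by simp [hk], by simp [hk']⟩
    · have := congrArg Fin.val e
      have := (f x).isLt
      simp at *; omega
    · have := congrArg Fin.val e
      have := (g x').isLt
      simp at *; omega
    · obtain ⟨k, hk, hk'⟩ := h2' x x' (Fin.natAdd_injective _ _ e)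
      exact ⟨Fin.natAdd p k, by simp [hk], by simp [hk']⟩

instance : TensorPushouts Inj.op where
  hasPushouts :=
    have (y n m : Inj.op.Ob) (f : y ⟶ n) (g : y ⟶ m) : HasColimit (span f g) := by
      revert f g
      change ℕ at y n m
      intro (f' : Fin n ↪ Fin y) (g' : Fin m ↪ Fin y)
      obtain ⟨p, ⟨e⟩⟩ := Finite.exists_equiv_fin {x : Fin n × Fin m // f' x.1 = g' x.2}
      let i : Fin p ↪ Fin n := ⟨fun k => (e.symm k).1.1, fun k k' h => e.symm.injective
        (Subtype.ext (Prod.ext h (g'.injective (by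
          rw [← (e.symm k).2, ← (e.symm k').2]; exact congrArg f' h))))⟩
      let j : Fin p ↪ Fin m := ⟨fun k => (e.symm k).1.2, fun k k' h => e.symm.injective
        (Subtype.ext (Prod.ext (f'.injective (by
          rw [(e.symm k).2, (e.symm k').2]; exact congrArg g' h)) h))⟩
      have h := (Inj.isPushout_op_iff f' g' i j).2 ⟨fun k => (e.symm k).2, fun x x' h =>
        ⟨e ⟨(x, x'), h⟩, congrArg (fun w => w.1.1) (e.symm_apply_apply _),
          congrArg (fun w => w.1.2) (e.symm_apply_apply _)⟩⟩
      exact h.hasPushout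
    hasPushouts_of_hasColimit_span _
  tensor {y n m p y' n' m' p' f g i j f' g' i' j'} h h' := by
    obtain ⟨h1, h2⟩ := (Inj.isPushout_op_iff f g i j).1 h
    obtain ⟨h1', h2'⟩ := (Inj.isPushout_op_iff f' g' i' j').1 h'
    exact (Inj.isPushout_op_iff (injTensor f f') (injTensor g g') (injTensor i i')
      (injTensor j j')).2 (injTensor_square h1 h2 h1' h2')

/-! ### The factorisation system on partial functions -/

/-- Partial surjections. -/
def isSurj : MorphismProperty PF.Ob :=
  fun (a b : ℕ) (f : Fin a → Option (Fin b)) => ∀ k, ∃ i, f i = some k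

/-- Injections, i.e. total injective functions. -/
def isInj : MorphismProperty PF.Ob :=
  fun (a b : ℕ) (f : Fin a → Option (Fin b)) => ∃ g : Fin a ↪ Fin b, ∀ i, f i = some (g i)

theorem isInj.total {a b : ℕ} {f : PF.Hom a b} (h : isInj (X := a) (Y := b) f) (i : Fin a) :
    f i ≠ none := by
  obtain ⟨g, hg⟩ := h; rw [hg]; simp

theorem isInj.inj {a b : ℕ} {f : PF.Hom a b} (h : isInj (X := a) (Y := b) f) {i j : Fin a}
    (e : f i = f j) : i = j := by
  obtain ⟨g, hg⟩ := h; rw [hg, hg] at e; exact g.injective (Option.some.inj e)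

/-- A cancellation property of injections. -/
theorem isInj.cancel {a b : ℕ} {f : PF.Hom a b} (h : isInj (X := a) (Y := b) f)
    {x y : Option (Fin a)} (e : x.bind f = y.bind f) : x = y := by
  rcases x with _ | x <;> rcases y with _ | y
  · rfl
  · exact absurd e.symm (h.total y)
  · exact absurd e (h.total x)
  · exact congrArg some (h.inj e)

theorem isInj_of_retract {a b : ℕ} {f : PF.Hom a b} {r : PF.Hom b a}
    (h : PF.comp f r = PF.id a) : isInj (X := a) (Y := b) f := by
  have h' : ∀ i, (f i).bind r = some i := fun i => congrFun h i
  choose g hg using fun i => Option.isSome_iff_exists.1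
    (show (f i).isSome by
      by_contra hn
      have := h' i
      rw [Option.not_isSome_iff_eq_none.1 hn] at this
      cases this)
  refine ⟨⟨g, fun i j e => ?_⟩, hg⟩
  have h1 := h' i
  have h2 := h' j
  rw [hg] at h1 h2
  rw [e] at h1
  exact Option.some.inj (h1.symm.trans h2)

theorem pf_fac {a b : ℕ} (f : Fin a → Option (Fin b)) :
    ∃ (z : ℕ) (e : Fin a → Option (Fin z)) (m : Fin z → Option (Fin b)),
      isSurj (X := a) (Y := z) e ∧ isInj (X := z) (Y := b) m ∧ (fun i => (e i).bind m) = f := by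
  classical
  obtain ⟨z, ⟨e⟩⟩ := Finite.exists_equiv_fin {k : Fin b // ∃ i, f i = some k}
  refine ⟨z, fun i => if h : ∃ k, f i = some k then some (e ⟨h.choose, i, h.choose_spec⟩)
    else none, fun l => some (e.symm l).1,
    fun l => ?_, ⟨⟨fun l => (e.symm l).1, fun l l' h => e.symm.injective (Subtype.ext h)⟩,
      fun _ => rfl⟩, funext fun i => ?_⟩
  · obtain ⟨i, hi⟩ := (e.symm l).2
    have h : ∃ k, f i = some k := ⟨_, hi⟩
    refine ⟨i, (dif_pos h).trans (congrArg some ?_)⟩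
    rw [← Equiv.eq_symm_apply]
    exact Subtype.ext (Option.some.inj (h.choose_spec.symm.trans hi))
  · by_cases h : ∃ k, f i = some k
    · simp only [dif_pos h]
      refine Eq.trans ?_ h.choose_spec.symm
      simp
    · simp only [dif_neg h]
      exact (Option.eq_none_iff_forall_ne_some.2 fun k hk => h ⟨k, hk⟩).symm

theorem pf_diag {x z y x' z' y' : ℕ} (e : Fin x → Option (Fin z)) (m : Fin z → Option (Fin y))
    (e' : Fin x' → Option (Fin z')) (m' : Fin z' → Option (Fin y')) (u : Fin x → Option (Fin x'))
    (v : Fin y → Option (Fin y')) (he : ∀ k, ∃ i, e i = some k)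
    (hm' : isInj (X := z') (Y := y') m')
    (h : (fun i => ((e i).bind m).bind v) = fun i => (u i).bind fun k => (e' k).bind m') :
    ∃! s : Fin z → Option (Fin z'), (fun i => (e i).bind s) = (fun i => (u i).bind e') ∧
      (fun i => (m i).bind v) = fun i => (s i).bind m' := by
  choose c hc using he
  have h' : ∀ i, ((e i).bind fun k => (m k).bind v) = ((u i).bind e').bind m' := fun i =>
    (Option.bind_assoc _ _ _).symm.trans ((congrFun h i).trans (Option.bind_assoc _ _ _).symm)
  refine ⟨fun k => (u (c k)).bind e', ⟨funext fun i => ?_, funext fun k => ?_⟩,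
    fun s hs => funext fun k => ?_⟩
  · refine isInj.cancel hm' ?_
    rw [← h', Option.bind_assoc]
    congr 1
    funext k
    rw [← h', hc]; rfl
  · have := h' (c k)
    rwa [hc] at this
  · have := congrFun hs.1 (c k)
    simp only [hc] at this
    exact this

/-- The factorisation system on partial functions given by partial surjections and injections. -/
def PFfact : CostableFactorisation PF.Ob where
  E := isSurj
  M := isInj
  E_mul :=
    { id_mem := fun _ k => ⟨k, rfl⟩
      comp_mem := fun {a b c} f g hf hg k => by
        obtain ⟨j, hj⟩ := hg k
        obtain ⟨i, hi⟩ := hf j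
        exact ⟨i, (congrArg (fun o => Option.bind o g) hi).trans hj⟩ }
  M_mul :=
    { id_mem := fun _ => ⟨Function.Embedding.refl _, fun _ => rfl⟩
      comp_mem := fun {a b c} f g ⟨f', hf⟩ ⟨g', hg⟩ => ⟨f'.trans g', fun i =>
        (congrArg (fun o => Option.bind o g) (hf i)).trans (hg _)⟩ }
  E_iso {a b} f := by
    rintro ⟨g, h1, h2⟩ k
    have e : (show Option (Fin a) from g k).bind f = some k := congrFun h2 k
    obtain ⟨i, _, hi⟩ := Option.bind_eq_some_iff.1 e
    exact ⟨i, hi⟩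
  M_iso f := by
    rintro ⟨g, h1, h2⟩
    exact isInj_of_retract (r := g) h1
  fac f := pf_fac f
  diag e m e' m' u v he _ _ hm' h := pf_diag e m e' m' u v he hm' h
  M_costable :=
    { of_isPushout := by
        classical
        intro (A : ℕ) (A' : ℕ) (B : ℕ) (B' : ℕ) f g f' g' sq ⟨φ, hφ⟩
        let q : Fin A' → Option (Fin B) := fun x =>
          if h : ∃ k, φ k = x then g h.choose else none
        have hq : ∀ k, q (φ k) = g k := fun k => by
          have h : ∃ k', φ k' = φ k := ⟨k, rfl⟩
          simp only [q, dif_pos h]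
          rw [φ.injective h.choose_spec]
        obtain ⟨r, h1, h2⟩ := sq.exists_desc (W := B) (PF.id B) q (funext fun k => by
          change Option.bind (g k) some = Option.bind (f k) q
          rw [hφ]
          rw [Option.bind_fun_some]; exact (hq k).symm)
        exact isInj_of_retract (r := r) h1 }

instance : TensorClosed PFfact.M where
  tensor := by
    rintro a b c d f g ⟨f', hf⟩ ⟨g', hg⟩
    refine ⟨injTensor f' g', fun i => ?_⟩
    have e1 : f = fun i => some (f' i) := funext hf
    have e2 : g = fun i => some (g' i) := funext hg
    subst e1 e2
    exact (congrFun (pfTensor_inj f' g') i).symm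

end PROP

/-! ### Partial equivalence relations -/

/-- A partial equivalence relation: a symmetric and transitive relation. -/
@[ext] structure PERel (X : Type) where
  rel : X → X → Prop
  symm {x y : X} : rel x y → rel y x
  trans {x y z : X} : rel x y → rel y z → rel x z

namespace PERel

theorem refl_left {X : Type} (e : PERel X) {x y : X} (h : e.rel x y) : e.rel x x :=
  e.trans h (e.symm h)

theorem refl_right {X : Type} (e : PERel X) {x y : X} (h : e.rel x y) : e.rel y y :=
  e.trans (e.symm h) h

/-- The kernel of a partial function: two elements are related if the function is defined and takes
the same value at both of them. -/
def ker {X Y : Type} (f : X → Option Y) : PERel X where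
  rel x y := ∃ k, f x = some k ∧ f y = some k
  symm := fun ⟨k, h, h'⟩ => ⟨k, h', h⟩
  trans := by
    rintro x y z ⟨k, h, h'⟩ ⟨l, h'', h'''⟩
    rw [h'] at h''
    cases h''
    exact ⟨k, h, h'''⟩

variable {A Z B : Type}

/-- Two elements of `A ⊎ Z ⊎ B` are directly linked if they are related by `e` or by `e'`. -/
def Step (e : PERel (A ⊕ Z)) (e' : PERel (Z ⊕ B)) (u v : A ⊕ (Z ⊕ B)) : Prop :=
  (∃ x y, e.rel x y ∧ Sum.map id Sum.inl x = u ∧ Sum.map id Sum.inl y = v) ∨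
    ∃ x y, e'.rel x y ∧ Sum.inr x = u ∧ Sum.inr y = v

/-- The gluing of `e` and `e'` along `Z`: the smallest partial equivalence relation on
`A ⊎ Z ⊎ B` that contains both. -/
def Glue (e : PERel (A ⊕ Z)) (e' : PERel (Z ⊕ B)) : A ⊕ (Z ⊕ B) → A ⊕ (Z ⊕ B) → Prop :=
  Relation.TransGen (Step e e')

theorem Step.symm {e : PERel (A ⊕ Z)} {e' : PERel (Z ⊕ B)} {u v : A ⊕ (Z ⊕ B)}
    (h : Step e e' u v) : Step e e' v u := by
  rcases h with ⟨x, y, h, hx, hy⟩ | ⟨x, y, h, hx, hy⟩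
  · exact Or.inl ⟨y, x, e.symm h, hy, hx⟩
  · exact Or.inr ⟨y, x, e'.symm h, hy, hx⟩

theorem Glue.symm {e : PERel (A ⊕ Z)} {e' : PERel (Z ⊕ B)} {u v : A ⊕ (Z ⊕ B)}
    (h : Glue e e' u v) : Glue e e' v u := by
  induction h with
  | single h => exact .single h.symm
  | tail _ h ih => exact .head h.symm ih

/-- Composition of partial equivalence relations: glue along `Z` and restrict to `A ⊎ B`, where an
element that is linked to an element of `Z` at which `e` or `e'` is undefined becomes undefined.
If `e` and `e'` are (total) equivalence relations the second clause is void, and this is the usual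
composition of equivalence relations. -/
def comp (e : PERel (A ⊕ Z)) (e' : PERel (Z ⊕ B)) : PERel (A ⊕ B) where
  rel x y := Glue e e' (Sum.map id Sum.inr x) (Sum.map id Sum.inr y) ∧
    ∀ z : Z, Glue e e' (Sum.map id Sum.inr x) (Sum.inr (Sum.inl z)) →
      e.rel (Sum.inr z) (Sum.inr z) ∧ e'.rel (Sum.inl z) (Sum.inl z)
  symm := fun ⟨h, h'⟩ => ⟨h.symm, fun z hz => h' z (h.trans hz)⟩
  trans := fun ⟨h, h'⟩ ⟨k, _⟩ => ⟨h.trans k, h'⟩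

/-- The disjoint union of two partial equivalence relations on `a ⊎ b` and on `c ⊎ d`. -/
def tensor {a b c d : ℕ} (e : PERel (Fin a ⊕ Fin b)) (e' : PERel (Fin c ⊕ Fin d)) :
    PERel (Fin (a + c) ⊕ Fin (b + d)) where
  rel u v :=
    (∃ x y, e.rel x y ∧ Sum.map (Fin.castAdd c) (Fin.castAdd d) x = u ∧
        Sum.map (Fin.castAdd c) (Fin.castAdd d) y = v) ∨
      ∃ x y, e'.rel x y ∧ Sum.map (Fin.natAdd a) (Fin.natAdd b) x = u ∧
        Sum.map (Fin.natAdd a) (Fin.natAdd b) y = v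
  symm := by
    rintro u v (⟨x, y, h, hx, hy⟩ | ⟨x, y, h, hx, hy⟩)
    · exact Or.inl ⟨y, x, e.symm h, hy, hx⟩
    · exact Or.inr ⟨y, x, e'.symm h, hy, hx⟩
  trans := by
    have disj : ∀ (x : Fin a ⊕ Fin b) (y : Fin c ⊕ Fin d),
        Sum.map (Fin.castAdd c) (Fin.castAdd d) x ≠ Sum.map (Fin.natAdd a) (Fin.natAdd b) y := by
      rintro (x | x) (y | y) h <;> simp [Fin.ext_iff] at h <;> have := x.isLt <;> omega
    have i1 : Function.Injective (Sum.map (Fin.castAdd (m := c) (n := a))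
        (Fin.castAdd (m := d) (n := b))) :=
      Function.Injective.sumMap (Fin.castAdd_injective _ _) (Fin.castAdd_injective _ _)
    have i2 : Function.Injective (Sum.map (Fin.natAdd (n := a) (m := c))
        (Fin.natAdd (n := b) (m := d))) :=
      Function.Injective.sumMap (Fin.natAdd_injective _ _) (Fin.natAdd_injective _ _)
    rintro u v w (⟨x, y, h, hx, hy⟩ | ⟨x, y, h, hx, hy⟩) (⟨x', y', h', hx', hy'⟩ | ⟨x', y', h', hx', hy'⟩)
    · cases i1 (hy.trans hx'.symm); exact Or.inl ⟨x, y', e.trans h h', hx, hy'⟩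
    · exact absurd (hy.trans hx'.symm) (disj _ _)
    · exact absurd (hy.trans hx'.symm).symm (disj _ _)
    · cases i2 (hy.trans hx'.symm); exact Or.inr ⟨x, y', e'.trans h h', hx, hy'⟩

/-- A union of equivalence classes. -/
def Closed {X : Type} (e : PERel X) (W : X → Prop) : Prop :=
  (∀ x, W x → e.rel x x) ∧ ∀ x y, e.rel x y → W x → W y

theorem closed_class {X : Type} (e : PERel X) (x : X) : e.Closed (e.rel x) :=
  ⟨fun _ h => e.refl_right h, fun _ _ h h' => e.trans h' h⟩

theorem ext_of_closed {X : Type} {e e' : PERel X} (h : ∀ W, e.Closed W ↔ e'.Closed W) : e = e' := by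
  have key : ∀ {e e' : PERel X}, (∀ W, e.Closed W ↔ e'.Closed W) → ∀ x y, e.rel x y → e'.rel x y := by
    intro e e' h x y hxy
    have h1 : e'.rel x x := ((h _).1 (e.closed_class x)).1 x (e.refl_left hxy)
    exact ((h _).2 (e'.closed_class x)).2 x y hxy h1
  ext x y
  exact ⟨key h x y, key (fun W => (h W).symm) x y⟩

theorem closed_ker {X Y : Type} (f : X → Y) (W : X → Prop) :
    (ker fun x => some (f x)).Closed W ↔ ∀ x y, f x = f y → W x → W y := by
  constructor
  · exact fun h x y hxy => h.2 x y ⟨f x, rfl, by rw [hxy]⟩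
  · refine fun h => ⟨fun x _ => ⟨f x, rfl, rfl⟩, fun x y ⟨k, hx, hy⟩ => h x y ?_⟩
    exact Option.some.inj (hx.trans hy.symm)

theorem closed_ker_graph {A B : Type} (f : A → B) (U : A → Prop) (V : B → Prop) :
    (ker (Sum.elim (fun a => some (f a)) some)).Closed (Sum.elim U V) ↔ U = V ∘ f := by
  have e : (Sum.elim (fun a => some (f a)) some : A ⊕ B → Option B) =
      fun x => some (Sum.elim f id x) := by funext x; cases x <;> rfl
  rw [e, closed_ker]
  constructor
  · exact fun h => funext fun a => propext
      ⟨h (Sum.inl a) (Sum.inr (f a)) rfl, h (Sum.inr (f a)) (Sum.inl a) rfl⟩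
  · rintro rfl x y hxy hx
    have key : ∀ x, Sum.elim (V ∘ f) V x ↔ V (Sum.elim f id x) := by rintro (x | x) <;> rfl
    rw [key] at hx ⊢
    rwa [← hxy]

theorem closed_comp (e : PERel (A ⊕ Z)) (e' : PERel (Z ⊕ B)) (U : A → Prop) (V : B → Prop) :
    (e.comp e').Closed (Sum.elim U V) ↔
      ∃ T : Z → Prop, e.Closed (Sum.elim U T) ∧ e'.Closed (Sum.elim T V) := by
  constructor
  · intro h
    let good : A ⊕ (Z ⊕ B) → Prop := fun w =>
      ∃ u, Sum.elim U V u ∧ Glue e e' (Sum.map id Sum.inr u) w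
    have g0 : ∀ u, good (Sum.map id Sum.inr u) ↔ Sum.elim U V u := fun u =>
      ⟨fun ⟨u', hu', hg⟩ => h.2 u' u ⟨hg, (h.1 u' hu').2⟩ hu', fun hu => ⟨u, hu, (h.1 u hu).1⟩⟩
    have gz : ∀ z, good (Sum.inr (Sum.inl z)) →
        e.rel (Sum.inr z) (Sum.inr z) ∧ e'.rel (Sum.inl z) (Sum.inl z) :=
      fun z ⟨u, hu, hg⟩ => (h.1 u hu).2 z hg
    have gs : ∀ u v, Step e e' u v → good u → good v := fun u v hs ⟨w, hw, hg⟩ =>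
      ⟨w, hw, hg.tail hs⟩
    have gl : ∀ w, good w → ∃ v, Step e e' w v := by
      rintro w ⟨u, hu, hg⟩
      obtain ⟨v, hv, _⟩ := Relation.TransGen.head'_iff.1 hg.symm
      exact ⟨v, hv⟩
    refine ⟨fun z => good (Sum.inr (Sum.inl z)), ?_, ?_⟩
    · have key : ∀ x, Sum.elim U (fun z => good (Sum.inr (Sum.inl z))) x ↔
          good (Sum.map id Sum.inl x) := by
        rintro (x | z)
        · exact (g0 (Sum.inl x)).symm
        · exact Iff.rfl
      refine ⟨fun x hx => ?_, fun x y hxy hx => ?_⟩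
      · rw [key] at hx
        rcases x with x | z
        · obtain ⟨v, ⟨x', y, hr, hx', _⟩ | ⟨x', y, _, hx', _⟩⟩ := gl _ hx
          · rcases x' with x' | z'
            · cases hx'; exact e.refl_left hr
            · cases hx'
          · cases hx'
        · exact (gz z hx).1
      · rw [key] at hx ⊢
        exact gs _ _ (Or.inl ⟨x, y, hxy, rfl, rfl⟩) hx
    · have key : ∀ x, Sum.elim (fun z => good (Sum.inr (Sum.inl z))) V x ↔ good (Sum.inr x) := by
        rintro (z | y)
        · exact Iff.rfl
        · exact (g0 (Sum.inr y)).symm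
      refine ⟨fun x hx => ?_, fun x y hxy hx => ?_⟩
      · rw [key] at hx
        rcases x with z | x
        · exact (gz z hx).2
        · obtain ⟨v, ⟨x', y, _, hx', _⟩ | ⟨x', y, hr, hx', _⟩⟩ := gl _ hx
          · rcases x' with x' | z' <;> cases hx'
          · cases hx'; exact e'.refl_left hr
      · rw [key] at hx ⊢
        exact gs _ _ (Or.inr ⟨x, y, hxy, rfl, rfl⟩) hx
  · rintro ⟨T, h, h'⟩
    let W : A ⊕ (Z ⊕ B) → Prop := Sum.elim U (Sum.elim T V)
    have w0 : ∀ u, W (Sum.map id Sum.inr u) ↔ Sum.elim U V u := by rintro (u | u) <;> rfl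
    have w1 : ∀ u, W (Sum.map id Sum.inl u) ↔ Sum.elim U T u := by rintro (u | u) <;> rfl
    have ws : ∀ u v, Step e e' u v → W u → W v := by
      rintro u v (⟨x, y, hr, rfl, rfl⟩ | ⟨x, y, hr, rfl, rfl⟩)
      · rw [w1, w1]; exact h.2 x y hr
      · exact h'.2 x y hr
    have wg : ∀ u v, Glue e e' u v → W u → W v := by
      intro u v hg hu
      induction hg with
      | single hs => exact ws _ _ hs hu
      | tail _ hs ih => exact ws _ _ hs ih
    refine ⟨fun u hu => ⟨?_, fun z hz => ?_⟩, fun u v hr hu => ?_⟩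
    · rcases u with u | u
      · exact .single (Or.inl ⟨Sum.inl u, Sum.inl u, h.1 (Sum.inl u) hu, rfl, rfl⟩)
      · exact .single (Or.inr ⟨Sum.inr u, Sum.inr u, h'.1 (Sum.inr u) hu, rfl, rfl⟩)
    · have hz' : T z := wg _ _ hz ((w0 u).2 hu)
      exact ⟨h.1 (Sum.inr z) hz', h'.1 (Sum.inl z) hz'⟩
    · exact (w0 v).1 (wg _ _ hr.1 ((w0 u).2 hu))

theorem closed_tensor {a b c d : ℕ} (e : PERel (Fin a ⊕ Fin b)) (e' : PERel (Fin c ⊕ Fin d))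
    (W : Fin (a + c) ⊕ Fin (b + d) → Prop) :
    (e.tensor e').Closed W ↔ e.Closed (W ∘ Sum.map (Fin.castAdd c) (Fin.castAdd d)) ∧
      e'.Closed (W ∘ Sum.map (Fin.natAdd a) (Fin.natAdd b)) := by
  have disj : ∀ (x : Fin a ⊕ Fin b) (y : Fin c ⊕ Fin d),
      Sum.map (Fin.castAdd c) (Fin.castAdd d) x ≠ Sum.map (Fin.natAdd a) (Fin.natAdd b) y := by
    rintro (x | x) (y | y) h <;> simp [Fin.ext_iff] at h <;> have := x.isLt <;> omega
  have i1 : Function.Injective (Sum.map (Fin.castAdd (m := c) (n := a))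
      (Fin.castAdd (m := d) (n := b))) :=
    Function.Injective.sumMap (Fin.castAdd_injective _ _) (Fin.castAdd_injective _ _)
  have i2 : Function.Injective (Sum.map (Fin.natAdd (n := a) (m := c))
      (Fin.natAdd (n := b) (m := d))) :=
    Function.Injective.sumMap (Fin.natAdd_injective _ _) (Fin.natAdd_injective _ _)
  constructor
  · refine fun h => ⟨⟨fun x hx => ?_, fun x y hxy hx => ?_⟩, ⟨fun x hx => ?_, fun x y hxy hx => ?_⟩⟩
    · rcases h.1 _ hx with ⟨x', y', hr, hx', hy'⟩ | ⟨x', y', hr, hx', hy'⟩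
      · cases i1 hx'; exact e.refl_left hr
      · exact absurd hx'.symm (disj _ _)
    · exact h.2 _ _ (Or.inl ⟨x, y, hxy, rfl, rfl⟩) hx
    · rcases h.1 _ hx with ⟨x', y', hr, hx', hy'⟩ | ⟨x', y', hr, hx', hy'⟩
      · exact absurd hx' (disj _ _)
      · cases i2 hx'; exact e'.refl_left hr
    · exact h.2 _ _ (Or.inr ⟨x, y, hxy, rfl, rfl⟩) hx
  · rintro ⟨h, h'⟩
    refine ⟨fun u hu => ?_, ?_⟩
    · have cover : (∃ x, Sum.map (Fin.castAdd c) (Fin.castAdd d) x = u) ∨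
          ∃ x, Sum.map (Fin.natAdd a) (Fin.natAdd b) x = u := by
        rcases u with u | u
        · exact PROP.fin_cases_add (motive := fun u => (∃ x, Sum.map (Fin.castAdd c) (Fin.castAdd d) x
            = Sum.inl u) ∨ ∃ x, Sum.map (Fin.natAdd a) (Fin.natAdd b) x = Sum.inl u) u
            (fun u => Or.inl ⟨Sum.inl u, rfl⟩) (fun u => Or.inr ⟨Sum.inl u, rfl⟩)
        · exact PROP.fin_cases_add (motive := fun u => (∃ x, Sum.map (Fin.castAdd c) (Fin.castAdd d) x
            = Sum.inr u) ∨ ∃ x, Sum.map (Fin.natAdd a) (Fin.natAdd b) x = Sum.inr u) u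
            (fun u => Or.inl ⟨Sum.inr u, rfl⟩) (fun u => Or.inr ⟨Sum.inr u, rfl⟩)
      rcases cover with ⟨x, rfl⟩ | ⟨x, rfl⟩
      · exact Or.inl ⟨x, x, h.1 x hu, rfl, rfl⟩
      · exact Or.inr ⟨x, x, h'.1 x hu, rfl, rfl⟩
    · rintro u v (⟨x, y, hr, rfl, rfl⟩ | ⟨x, y, hr, rfl, rfl⟩) hu
      · exact h.2 x y hr hu
      · exact h'.2 x y hr hu

end PERel

namespace PROP

/-- The graph of the inverse image map of a function. -/
def powGraph {a b : ℕ} (f : Fin b → Fin a) : (Fin a → Prop) → (Fin b → Prop) → Prop :=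
  fun U V => V = U ∘ f

/-- Composition of relations between powersets. -/
def powComp {a b c : ℕ} (R : (Fin a → Prop) → (Fin b → Prop) → Prop)
    (S : (Fin b → Prop) → (Fin c → Prop) → Prop) : (Fin a → Prop) → (Fin c → Prop) → Prop :=
  fun U V => ∃ T, R U T ∧ S T V

/-- Monoidal product of relations between powersets. -/
def powTensor {a b c d : ℕ} (R : (Fin a → Prop) → (Fin b → Prop) → Prop)
    (S : (Fin c → Prop) → (Fin d → Prop) → Prop) :
    (Fin (a + c) → Prop) → (Fin (b + d) → Prop) → Prop :=
  fun U V => R (U ∘ Fin.castAdd c) (V ∘ Fin.castAdd d) ∧ S (U ∘ Fin.natAdd a) (V ∘ Fin.natAdd b)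

theorem eqArrow_pow {a b : ℕ} (h : a = b) :
    eqArrow (H := fun a b => (Fin a → Prop) → (Fin b → Prop) → Prop) (fun _ => powGraph _root_.id) h
      = powGraph (Fin.cast h.symm) := by
  cases h; rfl

theorem ext_split {a b : ℕ} {U V : Fin (a + b) → Prop}
    (h : U ∘ Fin.castAdd b = V ∘ Fin.castAdd b) (h' : U ∘ Fin.natAdd a = V ∘ Fin.natAdd a) :
    U = V := by
  funext i; exact fin_cases_add i (congrFun h) (congrFun h')

theorem powComp_graph {a b c : ℕ} (f : Fin b → Fin a) (g : Fin c → Fin b) :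
    powComp (powGraph f) (powGraph g) = powGraph (f ∘ g) := by
  funext U V; simp [powComp, powGraph, Function.comp_assoc]

theorem powComp_graph_left {a b c : ℕ} (f : Fin b → Fin a)
    (S : (Fin b → Prop) → (Fin c → Prop) → Prop) :
    powComp (powGraph f) S = fun U V => S (U ∘ f) V := by
  funext U V; simp [powComp, powGraph]

theorem powComp_graph_right {a b c : ℕ} (R : (Fin a → Prop) → (Fin b → Prop) → Prop)
    (g : Fin c → Fin b) (g' : Fin b → Fin c) (h : ∀ x, g (g' x) = x) (h' : ∀ x, g' (g x) = x) :
    powComp R (powGraph g) = fun U V => R U (V ∘ g') := by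
  funext U V
  refine propext ⟨?_, fun hR => ⟨_, hR, funext fun x => congrArg V (h' x).symm⟩⟩
  rintro ⟨T, hT, rfl⟩
  convert hT using 1
  exact funext fun x => congrArg T (h x)

theorem powTensor_graph {a b c d : ℕ} (f : Fin b → Fin a) (g : Fin d → Fin c) :
    powTensor (powGraph f) (powGraph g) =
      powGraph (Fin.addCases (fun i => Fin.castAdd c (f i)) (fun i => Fin.natAdd a (g i))) := by
  funext U V
  refine propext ⟨fun ⟨h, h'⟩ => ext_split ?_ ?_, fun h => ?_⟩
  · rw [h]; funext i; simp
  · rw [h']; funext i; simp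
  · cases h
    exact ⟨by funext i; simp, by funext i; simp⟩

theorem swapFin_swapFin (a b : ℕ) (i : Fin (a + b)) : swapFin b a (swapFin a b i) = i := by
  refine fin_cases_add i (fun i => ?_) (fun i => ?_) <;> simp

/-- The auxiliary prop of relations between powersets. -/
def PowRel : PROP where
  Hom a b := (Fin a → Prop) → (Fin b → Prop) → Prop
  id _ := powGraph _root_.id
  comp := powComp
  id_comp R := powComp_graph_left _ R
  comp_id R := powComp_graph_right R _root_.id _root_.id (fun _ => rfl) (fun _ => rfl)
  assoc R S T := by
    funext U V
    exact propext ⟨fun ⟨X, ⟨Y, h, h'⟩, h''⟩ => ⟨Y, h, X, h', h''⟩,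
      fun ⟨Y, h, X, h', h''⟩ => ⟨X, ⟨Y, h, h'⟩, h''⟩⟩
  tensor := powTensor
  tensor_id a b := by
    rw [powTensor_graph]
    congr 1
    funext i
    refine fin_cases_add i (fun i => ?_) (fun i => ?_) <;> simp
  tensor_comp {a b c a' b' c'} R S R' S' := by
    funext U V
    refine propext ⟨?_, ?_⟩
    · rintro ⟨⟨T, h1, h2⟩, ⟨T', h3, h4⟩⟩
      refine ⟨Fin.addCases T T', ⟨?_, ?_⟩, ⟨?_, ?_⟩⟩
      · convert h1; funext i; simp
      · convert h3; funext i; simp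
      · convert h2; funext i; simp
      · convert h4; funext i; simp
    · rintro ⟨T, ⟨h1, h3⟩, ⟨h2, h4⟩⟩
      exact ⟨⟨_, h1, h2⟩, ⟨_, h3, h4⟩⟩
  tensor_assoc {a b a' b' a'' b''} R S T := by
    simp only [eqArrow_pow]
    rw [powComp_graph_left, powComp_graph_right _ _ (Fin.cast (Nat.add_assoc b b' b''))
      (fun _ => rfl) (fun _ => rfl)]
    funext U V
    have e1 : (U ∘ Fin.cast (Nat.add_assoc a a' a'').symm) ∘ Fin.natAdd a ∘ Fin.natAdd a' =
        U ∘ Fin.natAdd (a + a') :=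
      funext fun i => congrArg U (Fin.ext (by simp; omega))
    have e2 : (V ∘ Fin.cast (Nat.add_assoc b b' b'')) ∘ Fin.natAdd (b + b') =
        V ∘ Fin.natAdd b ∘ Fin.natAdd b' :=
      funext fun i => congrArg V (Fin.ext (by simp; omega))
    refine propext ⟨fun ⟨⟨h1, h2⟩, h3⟩ => ⟨h1, h2, ?_⟩, fun ⟨h1, h2, h3⟩ => ⟨⟨h1, h2⟩, ?_⟩⟩
    · change T ((U ∘ Fin.cast (Nat.add_assoc a a' a'').symm) ∘ Fin.natAdd a ∘ Fin.natAdd a')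
        (V ∘ Fin.natAdd b ∘ Fin.natAdd b')
      rwa [e1, ← e2]
    · rw [e2, ← e1]; exact h3
  unit_tensor {a b} R := by
    simp only [eqArrow_pow]
    rw [powComp_graph_left, powComp_graph_right _ _ (Fin.cast (Nat.zero_add b))
      (fun _ => rfl) (fun _ => rfl)]
    funext U V
    have e1 : U ∘ Fin.cast (Nat.zero_add a).symm = U ∘ Fin.natAdd 0 :=
      funext fun i => congrArg U (Fin.ext (by simp))
    have e2 : (V ∘ Fin.cast (Nat.zero_add b)) ∘ Fin.natAdd 0 = V :=
      funext fun i => congrArg V (Fin.ext (by simp))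
    simp only [powTensor, e2, e1]
    exact propext ⟨fun h => h.2, fun h => ⟨funext fun i => i.elim0, h⟩⟩
  tensor_unit {a b} R := by
    simp only [eqArrow_pow]
    rw [powComp_graph_left, powComp_graph_right _ (Fin.cast (Nat.add_zero b).symm)
      (Fin.cast (Nat.add_zero b)) (fun _ => rfl) (fun _ => rfl)]
    funext U V
    exact propext ⟨fun h => h.1, fun h => ⟨h, funext fun i => i.elim0⟩⟩
  symm a b := powGraph (swapFin b a)
  symm_natural {a b a' b'} R S := by
    rw [powComp_graph_left, powComp_graph_right _ _ (swapFin b b') (swapFin_swapFin b b')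
      (swapFin_swapFin b' b)]
    funext U V
    have e1 : ∀ {m n : ℕ} (W : Fin (m + n) → Prop), (W ∘ swapFin n m) ∘ Fin.castAdd m =
        W ∘ Fin.natAdd m := fun W => funext fun i => congrArg W (by simp)
    have e2 : ∀ {m n : ℕ} (W : Fin (m + n) → Prop), (W ∘ swapFin n m) ∘ Fin.natAdd n =
        W ∘ Fin.castAdd n := fun W => funext fun i => congrArg W (by simp)
    simp only [powTensor, e1, e2]
    exact propext And.comm
  symm_symm a b := by
    rw [powComp_graph]
    exact congrArg powGraph (funext fun i => swapFin_swapFin a b i)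
  hexagon a b c := by
    simp only [eqArrow_pow, powComp_graph, powTensor_graph]
    congr 1
    funext i
    refine fin_cases_add i (fun i => ?_) (fun i => ?_)
    · have e : Fin.cast (Nat.add_assoc b c a).symm (Fin.castAdd (c + a) i) =
          Fin.castAdd a (Fin.castAdd c i) := by ext; simp
      have e' : Fin.cast (Nat.add_assoc b a c).symm (Fin.castAdd (a + c) i) =
          Fin.castAdd c (Fin.castAdd a i) := by ext; simp
      simp [e, e']; ext; simp
    · refine fin_cases_add i (fun i => ?_) (fun i => ?_)
      · have e : Fin.cast (Nat.add_assoc b c a).symm (Fin.natAdd b (Fin.castAdd a i)) =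
            Fin.castAdd a (Fin.natAdd b i) := by ext; simp
        have e' : Fin.cast (Nat.add_assoc b a c).symm (Fin.natAdd b (Fin.natAdd a i)) =
            Fin.natAdd (b + a) i := by ext; simp [Nat.add_assoc]
        simp [e, e']; ext; simp [Nat.add_assoc]
      · have e : Fin.cast (Nat.add_assoc b c a).symm (Fin.natAdd b (Fin.natAdd c i)) =
            Fin.natAdd (b + c) i := by ext; simp [Nat.add_assoc]
        have e' : Fin.cast (Nat.add_assoc b a c).symm (Fin.natAdd b (Fin.castAdd c i)) =
            Fin.castAdd c (Fin.natAdd b i) := by ext; simp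
        simp [e, e']; ext; simp

/-- The unions of equivalence classes, as a relation between powersets. -/
def powClosed {a b : ℕ} (e : PERel (Fin a ⊕ Fin b)) : (Fin a → Prop) → (Fin b → Prop) → Prop :=
  fun U V => e.Closed (Sum.elim U V)

theorem powClosed_injective {a b : ℕ} (e e' : PERel (Fin a ⊕ Fin b))
    (h : powClosed e = powClosed e') : e = e' :=
  PERel.ext_of_closed fun W => by
    have := congrFun (congrFun h (W ∘ Sum.inl)) (W ∘ Sum.inr)
    rw [powClosed, powClosed, Sum.elim_comp_inl_inr] at this
    exact iff_of_eq this

theorem powClosed_ker {a b : ℕ} (f : Fin a → Fin b) (g : Fin b → Fin a) (h : ∀ i, f (g i) = i)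
    (h' : ∀ i, g (f i) = i) :
    powClosed (PERel.ker (Sum.elim (fun i => some (f i)) some)) = powGraph g := by
  funext U V
  refine propext ((PERel.closed_ker_graph f U V).trans ⟨?_, ?_⟩)
  · rintro rfl; exact funext fun i => congrArg V (h i).symm
  · rintro rfl; exact funext fun i => congrArg U (h' i).symm

/-- The prop of partial equivalence relations: an arrow `a ⟶ b` is a partial equivalence relation
on the disjoint union of `{0, …, a - 1}` and `{0, …, b - 1}`.  The identities and symmetries are the
partial equivalence relations that identify each element with its image under the identity, or under
the block permutation. -/
def PER : PROP :=
  ofFaithful PowRel (fun a b => PERel (Fin a ⊕ Fin b)) powClosed powClosed_injective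
    (fun a => PERel.ker (Sum.elim (fun i => some i) some : Fin a ⊕ Fin a → Option (Fin a)))
    (fun e e' => e.comp e') (fun e e' => e.tensor e')
    (fun a b => PERel.ker (Sum.elim (fun i => some (swapFin a b i)) some))
    (fun _ => powClosed_ker _root_.id _root_.id (fun _ => rfl) (fun _ => rfl))
    (fun e e' => by
      funext U V
      exact propext (PERel.closed_comp e e' U V))
    (fun e e' => by
      funext U V
      refine propext ((PERel.closed_tensor e e' _).trans ?_)
      rw [Sum.elim_comp_map, Sum.elim_comp_map]; rfl)
    (fun a b => powClosed_ker (swapFin a b) (swapFin b a) (swapFin_swapFin b a)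
      (swapFin_swapFin a b))

/-! ### The legs of the square -/

/-- The morphism from the coproduct of `Inj` and its opposite to cospans of partial functions. -/
noncomputable def toCospanPF : Inj ⨿ Inj.op ⟶ Cospan PF :=
  coprod.desc (injPF ≫ cospanOf PF) (Mor.op injPF ≫ cospanOfOp PF)

/-- The morphism from the coproduct of `Inj` and its opposite to spans of injections. -/
noncomputable def toSpanInj : Inj ⨿ Inj.op ⟶ Span Inj :=
  coprod.desc (spanOf Inj) (spanOfOp Inj)

end PROP

/-! Everything is compared through subsets. A partial equivalence relation is determined by its
closed subsets, the unions of its classes, so an arrow of `PER` is faithfully a relation between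
powersets, and gluing with propagation of undefinedness becomes plain relational composition
(`PERel.closed_comp`). For the kernel of a copairing [f, g], the closed subsets are the pairs of
inverse images under f and g of one subset of the apex. A subset is the same as a partial function
to a point, so the universal property of a pushout says that its subsets are the compatible pairs of
subsets (`PF.exists_preim_iff`). Hence composition of cospans is also relational composition
(`toPow_comp`), and the kernel is functorial without any analysis of a transitive closure.

The kernel is bijective on arrows. An injection between apexes does not change it. Factoring the
copairing makes a representative jointly surjective, and the kernel then determines the injection
into any other representative (`cmk_eq_of_surjective`). Surjectivity is the formation of quotients
on domains (`PERel.exists_ker`).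

A span of injections f, g yields the relation f⁻¹U = g⁻¹V. That composition by pullback is respected
amounts to this: subsets of two subobjects that agree on the intersection come from one subset of
the ambient set (`exists_subset_of_pullback`).

For the pushout property, corelations are cospans with one further relation: an injection m between
apexes may be removed, that is, the cospan (m, m) becomes an identity. In spans, m followed by its
opposite is already an identity, because the pullback of a monomorphism along itself is trivial. A
compatible pair of morphisms F, G therefore forces the relation on G (`map_mk_self`), and G descends
to corelations (`corelDesc`). Uniqueness holds because each corelation is the class of a cospan, and
the triangle with F commutes because spans are generated by injections and their opposites. The
second square is the first one transported along the isomorphism with `PER`. -/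

namespace PROP

/-! ### Inverse images of subsets along partial functions -/

/-- The inverse image of a subset along a partial function. -/
def preim {X Y : Type} (f : X → Option Y) (W : Y → Prop) : X → Prop :=
  fun x => ∃ k, f x = some k ∧ W k

theorem preim_some {X Y : Type} (f : X → Y) (W : Y → Prop) :
    preim (fun x => some (f x)) W = W ∘ f := by
  funext x; simp [preim]

theorem preim_bind {X Y Z : Type} (f : X → Option Y) (g : Y → Option Z) (W : Z → Prop) :
    preim (fun x => (f x).bind g) W = preim f (preim g W) := by
  funext x
  cases h : f x <;> simp [preim, h]

theorem preim_sumElim {X X' Y : Type} (f : X → Option Y) (g : X' → Option Y) (W : Y → Prop) :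
    preim (Sum.elim f g) W = Sum.elim (preim f W) (preim g W) := by
  funext x; cases x <;> rfl

open Classical in
/-- The partial function to a point that is defined on the given subset. -/
noncomputable def toPoint {a : ℕ} (W : Fin a → Prop) : PF.Hom a 1 :=
  fun x => if W x then some (0 : Fin 1) else none

theorem toPoint_injective {a : ℕ} {W W' : Fin a → Prop} (h : toPoint W = toPoint W') : W = W' := by
  funext x
  have := congrFun h x
  by_cases h1 : W x <;> by_cases h2 : W' x <;> simp [toPoint, h1, h2] at this ⊢

/-- Into a single point, a partial function carries no information beyond its domain. -/
theorem exists_toPoint {a : ℕ} (φ : PF.Hom a 1) : ∃ W, φ = toPoint W := by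
  refine ⟨fun x => φ x = some (0 : Fin 1), funext fun x => ?_⟩
  by_cases h : φ x = some (0 : Fin 1)
  · exact h.trans (if_pos h).symm
  · refine Eq.trans (Option.eq_none_iff_forall_ne_some.2 fun k hk => h ?_) (if_neg h).symm
    rw [hk, Subsingleton.elim k 0]

/-- Naturality of the bijection between subsets and arrows to `1`: it turns precomposition into
inverse image, so universal properties in `PF` can be read on subsets. -/
theorem comp_toPoint {a b : ℕ} (f : PF.Hom a b) (W : Fin b → Prop) :
    PF.comp f (toPoint W) = toPoint (preim f W) := by
  classical
  funext x
  change (f x).bind (toPoint W) = toPoint (preim f W) x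
  cases h : f x with
  | none => exact (if_neg fun ⟨k, hk, _⟩ => by rw [h] at hk; cases hk).symm
  | some k =>
    have e : preim f W x = W k := propext
      ⟨fun ⟨l, hl, hW⟩ => by rw [h] at hl; cases hl; exact hW, fun hW => ⟨k, h, hW⟩⟩
    change toPoint W k = toPoint (preim f W) x
    simp only [toPoint, e]

/-- A subset of a pushout of partial functions is a compatible pair of subsets. -/
theorem PF.exists_preim_iff {y n m p : ℕ} {f : PF.Hom y n} {g : PF.Hom y m} {i : PF.Hom n p}
    {j : PF.Hom m p} (h : IsPushout (C := PF.Ob) f g i j) (A : Fin n → Prop) (B : Fin m → Prop) :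
    (∃ W, preim i W = A ∧ preim j W = B) ↔ preim f A = preim g B := by
  have hw : PF.comp f i = PF.comp g j := h.w
  constructor
  · rintro ⟨W, rfl, rfl⟩
    apply toPoint_injective
    rw [← comp_toPoint, ← comp_toPoint, ← comp_toPoint, ← comp_toPoint, ← PF.assoc, hw, PF.assoc]
  · intro e
    -- The universal property is tested on the one-point object: compatible subsets are a cocone
    -- with vertex `1`.
    obtain ⟨d, h1, h2⟩ := h.exists_desc (W := (1 : ℕ)) (toPoint A) (toPoint B) (by
      change PF.comp f (toPoint A) = PF.comp g (toPoint B)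
      rw [comp_toPoint, comp_toPoint, e])
    obtain ⟨W, rfl⟩ := exists_toPoint d
    exact ⟨W, toPoint_injective ((comp_toPoint i W).symm.trans h1),
      toPoint_injective ((comp_toPoint j W).symm.trans h2)⟩

/-- The classes of a kernel are the nonempty fibres, so a closed subset is the inverse image of its
own image. Points where `h` is undefined lie in no closed subset, just as they lie in no inverse
image. -/
theorem PERel.closed_ker_iff {X Y : Type} (h : X → Option Y) (P : X → Prop) :
    (PERel.ker h).Closed P ↔ ∃ W, preim h W = P := by
  constructor
  · intro hP
    refine ⟨fun k => ∃ x, h x = some k ∧ P x, funext fun x => propext ⟨?_, fun hx => ?_⟩⟩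
    · rintro ⟨k, hk, y, hy, hPy⟩
      exact hP.2 y x ⟨k, hy, hk⟩ hPy
    · obtain ⟨k, hk, _⟩ := hP.1 x hx
      exact ⟨k, hk, x, hk, hx⟩
  · rintro ⟨W, rfl⟩
    refine ⟨fun x ⟨k, hk, _⟩ => ⟨k, hk, hk⟩, ?_⟩
    rintro x y ⟨k, hx, hy⟩ ⟨l, hl, hW⟩
    cases hx.symm.trans hl
    exact ⟨k, hy, hW⟩

/-- The relation between powersets given by a cospan of partial functions. -/
theorem powClosed_ker_sumElim {a b n : ℕ} (f : PF.Hom a n) (g : PF.Hom b n)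
    (U : Fin a → Prop) (V : Fin b → Prop) :
    powClosed (PERel.ker (Sum.elim f g)) U V ↔ ∃ W, preim f W = U ∧ preim g W = V := by
  refine (PERel.closed_ker_iff _ _).trans (exists_congr fun W => ?_)
  exact (iff_of_eq (congrArg (· = _) (preim_sumElim _ _ W))).trans Sum.elim_eq_iff

/-! ### Corelations of partial functions and partial equivalence relations -/

/-- Totality of `μ` preserves the domain of definition and injectivity creates no new coincidences.
This makes the kernel well defined on corelations. -/
theorem PERel.ker_bind_embedding {X Y Z : Type} (h : X → Option Y) (μ : Y ↪ Z) :
    PERel.ker (fun x => (h x).bind fun k => some (μ k)) = PERel.ker h := by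
  ext x y
  constructor
  · rintro ⟨k, hx, hy⟩
    obtain ⟨u, hu, e⟩ := Option.bind_eq_some_iff.1 hx
    obtain ⟨v, hv, e'⟩ := Option.bind_eq_some_iff.1 hy
    cases μ.injective (Option.some.inj (e.trans e'.symm))
    exact ⟨_, hu, hv⟩
  · rintro ⟨k, hx, hy⟩
    exact ⟨μ k, by simp [hx], by simp [hy]⟩

/-- The kernel of the copairing of the legs of a cospan, as a map on corelations. -/
def kerMap {a b : ℕ} : CospMod PFfact.M a b → PERel (Fin a ⊕ Fin b) :=
  Quot.lift (fun s => PERel.ker (Sum.elim s.left s.right)) (by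
    rintro s t ⟨m, ⟨μ, hμ⟩, hl, hr⟩
    obtain rfl : m = fun k => some (μ k) := funext hμ
    refine (PERel.ker_bind_embedding _ μ).symm.trans (congrArg PERel.ker (funext fun x => ?_))
    rcases x with x | x
    · exact congrFun hl x
    · exact congrFun hr x)

/-- Cospans with the same kernel represent the same corelation. -/
theorem cmk_eq_of_surjective {a b n n' : ℕ} (f : PF.Hom a n) (g : PF.Hom b n) (f' : PF.Hom a n')
    (g' : PF.Hom b n') (hs : ∀ k, ∃ x, (Sum.elim f g : _ → Option (Fin n)) x = some k)
    (h : PERel.ker (Sum.elim f g : _ → Option (Fin n)) = PERel.ker (Sum.elim f' g')) :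
    cmk PFfact.M f g = cmk PFfact.M f' g' := by
  have hrel : ∀ x y, (∃ k, (Sum.elim f g : _ → Option (Fin n)) x = some k ∧
      (Sum.elim f g : _ → Option (Fin n)) y = some k) ↔
      ∃ k, (Sum.elim f' g' : _ → Option (Fin n')) x = some k ∧
      (Sum.elim f' g' : _ → Option (Fin n')) y = some k := fun x y =>
    iff_of_eq (congrFun (congrFun (congrArg PERel.rel h) x) y)
  choose c hc using hs
  -- The kernels have the same domain, since being related to itself means being in the domain. So
  -- the second copairing is defined at the chosen preimage `c k`, and its value there is the only
  -- possible image of `k` under an arrow between the apexes.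
  have hσ : ∀ k, ∃ l, (Sum.elim f' g' : _ → Option (Fin n')) (c k) = some l := fun k =>
    let ⟨l, hl, _⟩ := (hrel (c k) (c k)).1 ⟨k, hc k, hc k⟩
    ⟨l, hl⟩
  choose σ hσ using hσ
  have key : ∀ x, ((Sum.elim f g : _ → Option (Fin n)) x).bind (fun k => some (σ k)) =
      (Sum.elim f' g' : _ → Option (Fin n')) x := by
    intro x
    cases hx : (Sum.elim f g : _ → Option (Fin n)) x with
    | some k =>
      obtain ⟨l, h1, h2⟩ := (hrel x (c k)).1 ⟨k, hx, hc k⟩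
      rw [hσ] at h2
      cases h2
      exact h1.symm
    | none =>
      symm
      refine Option.eq_none_iff_forall_ne_some.2 fun l hl => ?_
      obtain ⟨k, hk, _⟩ := (hrel x x).2 ⟨l, hl, hl⟩
      rw [hx] at hk; cases hk
  refine cmk_sound (M := PFfact.M) (fun k => some (σ k)) ⟨⟨σ, fun k k' e => ?_⟩, fun _ => rfl⟩
    (funext fun x => key (Sum.inl x)) (funext fun x => key (Sum.inr x))
  -- Injectivity of `σ`: equal values of the second copairing at `c k` and `c k'` make these points
  -- related, hence the first copairing identifies them too.
  obtain ⟨l, h1, h2⟩ := (hrel (c k) (c k')).2 ⟨σ k, hσ k, by rw [e]; exact hσ k'⟩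
  rw [hc] at h1 h2
  exact Option.some.inj (h1.trans h2.symm)

/-- Each corelation is represented by a jointly surjective cospan. -/
theorem exists_surjective_cmk {a b : ℕ} (s : CospMod PFfact.M a b) :
    ∃ (n : ℕ) (f : PF.Hom a n) (g : PF.Hom b n),
      (∀ k, ∃ x, (Sum.elim f g : _ → Option (Fin n)) x = some k) ∧ s = cmk PFfact.M f g := by
  obtain ⟨n, f, g⟩ := s
  -- The copairing is factored as a whole. Its partial surjection provides the new legs, and its
  -- injection is the arrow between apexes that witnesses the equality of corelations.
  obtain ⟨z, e, m, he, hm, hem⟩ := pf_fac (Fin.addCases f g : Fin (a + b) → Option (Fin n))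
  refine ⟨z, fun x => e (Fin.castAdd b x), fun x => e (Fin.natAdd a x), fun k => ?_,
    (cmk_sound (M := PFfact.M) m hm (funext fun x => ?_) (funext fun x => ?_)).symm⟩
  · obtain ⟨x, hx⟩ := he k
    revert hx
    exact fin_cases_add x (fun x hx => ⟨Sum.inl x, hx⟩) (fun x hx => ⟨Sum.inr x, hx⟩)
  · exact (congrFun hem (Fin.castAdd b x)).trans (Fin.addCases_left x)
  · exact (congrFun hem (Fin.natAdd a x)).trans (Fin.addCases_right x)

/-- Joint surjectivity is needed for one of the two representatives only; the other may have apex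
points outside the image. -/
theorem kerMap_injective {a b : ℕ} : Function.Injective (kerMap (a := a) (b := b)) := by
  intro s t h
  obtain ⟨n, f, g, hs, rfl⟩ := exists_surjective_cmk s
  obtain ⟨n', f', g', _, rfl⟩ := exists_surjective_cmk t
  exact cmk_eq_of_surjective f g f' g' hs h

/-- On its domain `e` is a genuine equivalence relation with finitely many classes. The partial
function sends a point of the domain to its class and is undefined elsewhere. -/
theorem PERel.exists_ker {X : Type} [Finite X] (e : PERel X) :
    ∃ (n : ℕ) (h : X → Option (Fin n)), PERel.ker h = e := by
  classical
  let S : Setoid {x // e.rel x x} :=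
    ⟨fun x y => e.rel x.1 y.1, fun x => x.2, fun h => e.symm h, fun h h' => e.trans h h'⟩
  obtain ⟨n, ⟨ε⟩⟩ := Finite.exists_equiv_fin (Quotient S)
  refine ⟨n, fun x => if h : e.rel x x then some (ε (Quotient.mk S ⟨x, h⟩)) else none, ?_⟩
  ext x y
  constructor
  · rintro ⟨k, hx, hy⟩
    by_cases h : e.rel x x <;> by_cases h' : e.rel y y <;> simp only [h, h', dite_true, dite_false,
      Option.some.injEq, reduceCtorEq] at hx hy
    exact Quotient.exact (ε.injective (hx.trans hy.symm))
  · intro h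
    refine ⟨ε (Quotient.mk S ⟨x, e.refl_left h⟩), dif_pos (e.refl_left h), ?_⟩
    refine (dif_pos (e.refl_right h)).trans (congrArg (fun q => some (ε q)) ?_)
    exact Quotient.sound (e.symm h)

theorem kerMap_surjective {a b : ℕ} : Function.Surjective (kerMap (a := a) (b := b)) := by
  intro e
  obtain ⟨n, h, rfl⟩ := PERel.exists_ker e
  exact ⟨cmk PFfact.M (C := PF) (fun x => h (Sum.inl x)) (fun x => h (Sum.inr x)),
    congrArg PERel.ker (Sum.elim_comp_inl_inr h)⟩

/-! ### Functoriality of the kernel, checked on powersets -/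

theorem preim_castAdd {a b c d : ℕ} (f : PF.Hom a b) (g : PF.Hom c d) (W : Fin (b + d) → Prop) :
    preim (PF.tensor f g) W ∘ Fin.castAdd c = preim f (W ∘ Fin.castAdd d) := by
  funext x
  refine (congrArg (fun o => ∃ k, o = some k ∧ W k) (pfTensor_castAdd f g x)).trans (propext ?_)
  constructor
  · rintro ⟨k, hk, hW⟩
    obtain ⟨l, hl, rfl⟩ := Option.map_eq_some_iff.1 hk
    exact ⟨l, hl, hW⟩
  · rintro ⟨l, hl, hW⟩
    exact ⟨_, Option.map_eq_some_iff.2 ⟨l, hl, rfl⟩, hW⟩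

theorem preim_natAdd {a b c d : ℕ} (f : PF.Hom a b) (g : PF.Hom c d) (W : Fin (b + d) → Prop) :
    preim (PF.tensor f g) W ∘ Fin.natAdd a = preim g (W ∘ Fin.natAdd b) := by
  funext x
  refine (congrArg (fun o => ∃ k, o = some k ∧ W k) (pfTensor_natAdd f g x)).trans (propext ?_)
  constructor
  · rintro ⟨k, hk, hW⟩
    obtain ⟨l, hl, rfl⟩ := Option.map_eq_some_iff.1 hk
    exact ⟨l, hl, hW⟩
  · rintro ⟨l, hl, hW⟩
    exact ⟨_, Option.map_eq_some_iff.2 ⟨l, hl, rfl⟩, hW⟩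

/-- The relation between powersets given by a corelation of partial functions. -/
def toPow {a b : ℕ} (s : CospMod PFfact.M a b) : (Fin a → Prop) → (Fin b → Prop) → Prop :=
  powClosed (kerMap s)

/-- Two faithful passages, to kernels and then to closed subsets. Equations between corelations may
therefore be verified on subsets, without exhibiting injections between apexes. -/
theorem toPow_injective {a b : ℕ} : Function.Injective (toPow (a := a) (b := b)) :=
  fun _ _ h => kerMap_injective (powClosed_injective _ _ h)

theorem toPow_cmk {a b n : ℕ} (f : PF.Hom a n) (g : PF.Hom b n) (U : Fin a → Prop)
    (V : Fin b → Prop) :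
    toPow (cmk PFfact.M f g) U V ↔ ∃ W, preim f W = U ∧ preim g W = V :=
  powClosed_ker_sumElim f g U V

/-- A subset of the composite apex is a pair of subsets of the two apexes with the same inverse
image on the middle object. That common inverse image is the intermediate subset of the relational
composite. -/
theorem toPow_comp {a b c : ℕ} (s : CospMod PFfact.M a b) (t : CospMod PFfact.M b c) :
    toPow (ccomp PFfact.M s t) = powComp (toPow s) (toPow t) := by
  obtain ⟨n, f, g⟩ := s
  obtain ⟨n', f', g'⟩ := t
  obtain ⟨p, i, j, h⟩ := exists_pushout g f'
  have e := ccomp_eq PFfact.M f g f' g' h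
  funext U V
  refine (congrFun (congrFun (congrArg toPow e) U) V).trans (propext ?_)
  refine (toPow_cmk _ _ U V).trans (Iff.trans ?_ (exists_congr fun T =>
    and_congr (toPow_cmk f g U T) (toPow_cmk f' g' T V)).symm)
  have e1 := preim_bind f i
  have e2 := preim_bind g' j
  constructor
  · rintro ⟨W, rfl, rfl⟩
    exact ⟨preim g (preim i W), ⟨preim i W, (e1 W).symm, rfl⟩, preim j W,
      ((PF.exists_preim_iff h _ _).1 ⟨W, rfl, rfl⟩).symm, (e2 W).symm⟩
  · rintro ⟨T, ⟨A, rfl, rfl⟩, B, hB, rfl⟩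
    obtain ⟨W, rfl, rfl⟩ := (PF.exists_preim_iff h A B).2 hB.symm
    exact ⟨W, e1 W, e2 W⟩

/-- A subset of a disjoint union of apexes is a pair of subsets, and inverse images are taken
summand by summand. -/
theorem toPow_tensor {a b c d : ℕ} (s : CospMod PFfact.M a b) (t : CospMod PFfact.M c d) :
    toPow (ctensor PFfact.M s t) = powTensor (toPow s) (toPow t) := by
  obtain ⟨n, f, g⟩ := s
  obtain ⟨n', f', g'⟩ := t
  funext U V
  refine propext ((toPow_cmk (PF.tensor f f') (PF.tensor g g') U V).trans (Iff.trans ?_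
    (and_congr (toPow_cmk f g _ _) (toPow_cmk f' g' _ _)).symm))
  constructor
  · rintro ⟨W, rfl, rfl⟩
    exact ⟨⟨_, (preim_castAdd f f' W).symm, (preim_castAdd g g' W).symm⟩,
      ⟨_, (preim_natAdd f f' W).symm, (preim_natAdd g g' W).symm⟩⟩
  · rintro ⟨⟨W, h1, h2⟩, ⟨W', h3, h4⟩⟩
    let T : Fin (n + n') → Prop := Fin.addCases W W'
    have w1 : T ∘ Fin.castAdd n' = W := funext fun k => Fin.addCases_left (motive := fun _ => Prop) k
    have w2 : T ∘ Fin.natAdd n = W' := funext fun k => Fin.addCases_right (motive := fun _ => Prop) k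
    refine ⟨T, ext_split ?_ ?_, ext_split ?_ ?_⟩
    · rw [preim_castAdd, w1, h1]
    · rw [preim_natAdd, w2, h3]
    · rw [preim_castAdd, w1, h2]
    · rw [preim_natAdd, w2, h4]

/-- The morphism of props sending a corelation of partial functions to its kernel. -/
def corelToPER : Corel PF PFfact ⟶ PER :=
  Mor.mk (P := Corel PF PFfact) (Q := PER) (fun s => kerMap s) (fun _ => rfl)
    -- Both composites have the same closed subsets: `toPow_comp` computes those of the composite
    -- corelation, `PERel.closed_comp` those of the composite in `PER`.
    (fun s t => powClosed_injective _ _ ((toPow_comp s t).trans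
      (funext fun U => funext fun V => propext (PERel.closed_comp _ _ U V)).symm))
    (fun s t => powClosed_injective _ _ ((toPow_tensor s t).trans (by
      funext U V
      refine propext (((PERel.closed_tensor _ _ _).trans ?_)).symm
      rw [Sum.elim_comp_map, Sum.elim_comp_map]; rfl)))
    (fun _ _ => rfl)

/-- A morphism of props that is bijective on arrows is an isomorphism. -/
noncomputable def isoOfBijective {P Q : PROP} (F : P ⟶ Q)
    (h : ∀ a b, Function.Bijective (F.map (a := a) (b := b))) : P ≅ Q :=
  let inv {a b : ℕ} (f : Q.Hom a b) : P.Hom a b := (Equiv.ofBijective _ (h a b)).symm f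
  have right {a b : ℕ} (f : Q.Hom a b) : F.map (inv f) = f :=
    (Equiv.ofBijective _ (h a b)).apply_symm_apply f
  have left {a b : ℕ} (f : P.Hom a b) : inv (F.map f) = f :=
    (Equiv.ofBijective _ (h a b)).symm_apply_apply f
  { hom := F
    inv := Mor.mk (P := Q) (Q := P) inv
      -- Each law for the inverse is checked after applying `F`, which is injective on arrows.
      (fun a => (h a a).1 (by rw [right, F.map_id]))
      (fun {a b c} f g => (h a c).1 (by rw [right, F.map_comp, right, right]))
      (fun {a b c d} f g => (h (a + c) (b + d)).1 (by rw [right, F.map_tensor, right, right]))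
      (fun a b => (h (a + b) (b + a)).1 (by rw [right, F.map_symm]))
    hom_inv_id := hom_ext left
    inv_hom_id := hom_ext right }

/-- Corelations of partial functions are partial equivalence relations. -/
noncomputable def corelIsoPER : Corel PF PFfact ≅ PER :=
  isoOfBijective corelToPER fun _ _ => ⟨kerMap_injective, kerMap_surjective⟩

/-! ### From spans of injections to corelations -/

/-- Compatible subsets of two subsets agree with a subset of the union. -/
theorem exists_subset_of_pullback {y n m p : ℕ} {f : Fin n ↪ Fin y} {g : Fin m ↪ Fin y}
    {i : Fin p ↪ Fin n} {j : Fin p ↪ Fin m} (h : ∀ k, f (i k) = g (j k))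
    (h' : ∀ x x', f x = g x' → ∃ k, i k = x ∧ j k = x') (A : Fin n → Prop) (B : Fin m → Prop) :
    (∃ T : Fin y → Prop, A = T ∘ f ∧ T ∘ g = B) ↔ A ∘ i = B ∘ j := by
  constructor
  · rintro ⟨T, rfl, rfl⟩
    exact funext fun k => congrArg T (h k)
  · intro e
    -- By the pullback property a coincidence of values comes from a point of the intersection,
    -- where the two subsets agree.
    have e' : ∀ x x', f x = g x' → (A x ↔ B x') := fun x x' hx => by
      obtain ⟨k, rfl, rfl⟩ := h' x x' hx
      exact iff_of_eq (congrFun e k)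
    -- The witness is the union of the two direct images. Injectivity of the legs and `e'` prevent
    -- it from cutting out more than `A` and `B`.
    refine ⟨fun z => (∃ x, f x = z ∧ A x) ∨ ∃ x, g x = z ∧ B x, funext fun x => propext ?_,
      funext fun x => propext ?_⟩
    · refine ⟨fun hx => Or.inl ⟨x, rfl, hx⟩, ?_⟩
      rintro (⟨x', hx, hA⟩ | ⟨x', hx, hB⟩)
      · rwa [← f.injective hx]
      · exact (e' x x' hx.symm).2 hB
    · refine ⟨?_, fun hx => Or.inr ⟨x, rfl, hx⟩⟩
      rintro (⟨x', hx, hA⟩ | ⟨x', hx, hB⟩)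
      · exact (e' x' x hx).1 hA
      · rwa [← g.injective hx]

/-- The corelation represented by the pushout in partial functions of a span of injections. -/
noncomputable def spanCorel {a b n : ℕ} (f : Inj.Hom n a) (g : Inj.Hom n b) :
    CospMod PFfact.M a b :=
  ccomp PFfact.M (cmk PFfact.M (PF.id a) (injPF.map f)) (cmk PFfact.M (injPF.map g) (PF.id b))

/-- The first factor relates `U` to `U ∘ f`, the second relates `V ∘ g` to `V`, so composing them
just equates the two subsets of the apex of the span. -/
theorem toPow_spanCorel {a b n : ℕ} (f : Fin n ↪ Fin a) (g : Fin n ↪ Fin b) (U : Fin a → Prop)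
    (V : Fin b → Prop) : toPow (spanCorel f g) U V ↔ U ∘ f = V ∘ g := by
  have hid : ∀ {c : ℕ} (W : Fin c → Prop), preim (PF.id c) W = W := fun W => preim_some _root_.id W
  have hf : ∀ {m c : ℕ} (f : Fin m ↪ Fin c) (W : Fin c → Prop),
      preim (injPF.map (show Inj.Hom m c from f)) W = W ∘ f := fun f W => preim_some f W
  refine (iff_of_eq (congrFun (congrFun (toPow_comp _ _) U) V)).trans ?_
  refine (exists_congr fun T => and_congr (toPow_cmk _ _ U T) (toPow_cmk _ _ T V)).trans ?_
  simp only [hid, hf]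
  constructor
  · rintro ⟨T, ⟨W, rfl, rfl⟩, ⟨W', h, rfl⟩⟩; exact h.symm
  · exact fun h => ⟨_, ⟨U, rfl, rfl⟩, ⟨V, h.symm, rfl⟩⟩

/-- The outer legs of the two factors are identities, so composing them along any pushout of `f` and
`g` leaves exactly the legs of that pushout. -/
theorem spanCorel_of_isPushout {a b n p : ℕ} (f : Inj.Hom n a) (g : Inj.Hom n b)
    (i : PF.Hom a p) (j : PF.Hom b p)
    (h : IsPushout (C := PF.Ob) (injPF.map f) (injPF.map g) i j) :
    spanCorel f g = cmk PFfact.M i j := by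
  rw [spanCorel, ccomp_eq PFfact.M _ _ _ _ h, PF.id_comp, PF.id_comp]

/-- The morphism of props sending a span of injections to the class of its pushout cospan. -/
noncomputable def spanToCorel : Span Inj ⟶ Corel PF PFfact :=
  Mor.mk (P := Span Inj) (Q := Corel PF PFfact)
    (Quot.lift (fun s => spanCorel s.left s.right) (by
      rintro ⟨n, (f : Fin n ↪ _), (g : Fin n ↪ _)⟩ ⟨n', f', g'⟩
        ⟨(m : Fin n' ↪ Fin n), ⟨(m' : Fin n ↪ Fin n'), h1, h2⟩, hl, hr⟩
      obtain rfl : m.trans f = f' := hl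
      obtain rfl : m.trans g = g' := hr
      have hm : ∀ k, m (m' k) = k := fun k => DFunLike.congr_fun (F := Fin n ↪ Fin n) h1 k
      -- On subsets the corelation is the condition `U ∘ f = V ∘ g`, which does not change under
      -- precomposition with the bijection `m`.
      apply toPow_injective
      funext U V
      refine propext ((toPow_spanCorel f g U V).trans
        (Iff.trans ?_ (toPow_spanCorel (m.trans f) (m.trans g) U V).symm))
      refine ⟨fun h => funext fun k => congrFun h (m k), fun h => funext fun k => ?_⟩
      have := congrFun h (m' k)
      simp only [Function.comp, Function.Embedding.trans_apply, hm] at this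
      exact this))
    (fun a => ccomp_left PFfact.M (PF.id a) (PF.id a) (PF.id a) |>.trans (by rw [PF.id_comp]; rfl))
    (by
      rintro a b c ⟨⟨n, (f : Fin n ↪ Fin a), (g : Fin n ↪ Fin b)⟩⟩
        ⟨⟨n', (f' : Fin n' ↪ Fin b), (g' : Fin n' ↪ Fin c)⟩⟩
      obtain ⟨p, (i : Fin p ↪ Fin n), (j : Fin p ↪ Fin n'), h⟩ :=
        exists_pushout (C := Inj.op) (y := b) (n := n) (m := n') g f'
      obtain ⟨h1, h2⟩ := (Inj.isPushout_op_iff g f' i j).1 h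
      refine (congrArg _ (ccomp_eq (C := Inj.op) (MorphismProperty.isomorphisms Inj.op.Ob)
        (a := a) (b := b) (c := c) f g f' g' h)).trans ?_
      change spanCorel (i.trans f) (j.trans g') = ccomp PFfact.M (spanCorel f g) (spanCorel f' g')
      -- On subsets the claim is that `U ∘ f` and `V ∘ g'` agree on the pullback iff both are
      -- restrictions of one subset of the middle object, which is `exists_subset_of_pullback`.
      apply toPow_injective
      rw [toPow_comp]
      funext U V
      refine propext ((toPow_spanCorel (i.trans f) (j.trans g') U V).trans (Iff.trans ?_
        (exists_congr fun T =>
          and_congr (toPow_spanCorel f g U T) (toPow_spanCorel f' g' T V)).symm))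
      exact (exists_subset_of_pullback h1 h2 (U ∘ f) (V ∘ g')).symm)
    (by
      rintro a b c d ⟨⟨n, f, g⟩⟩ ⟨⟨n', f', g'⟩⟩
      -- Since `spanCorel` is a composite of two corelations, the interchange law of the target prop
      -- reduces this case to the tensors of the legs.
      refine Eq.trans ?_ ((Corel PF PFfact).tensor_comp (cmk PFfact.M (PF.id a) (injPF.map f))
        (cmk PFfact.M (injPF.map g) (PF.id b)) (cmk PFfact.M (PF.id c) (injPF.map f'))
        (cmk PFfact.M (injPF.map g') (PF.id d))).symm
      change ccomp PFfact.M (cmk PFfact.M _ (injPF.map (Inj.tensor f f')))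
        (cmk PFfact.M (injPF.map (Inj.tensor g g')) _) =
        ccomp PFfact.M (cmk PFfact.M (PF.tensor _ _) (PF.tensor _ _))
        (cmk PFfact.M (PF.tensor _ _) (PF.tensor _ _))
      rw [PF.tensor_id, PF.tensor_id]
      exact congrArg₂ (fun u v => ccomp PFfact.M (cmk PFfact.M (PF.id (a + c)) u)
        (cmk PFfact.M v (PF.id (b + d)))) (injPF.map_tensor f f') (injPF.map_tensor g g'))
    -- A symmetry in spans has its permutation on the reversed leg, because spans are cospans in the
    -- opposite prop; `cmk_symm` moves it to the forward leg.
    (fun a b => by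
      change ccomp PFfact.M (cmk PFfact.M (PF.id (a + b)) (injPF.map (Inj.symm b a)))
        (cmk PFfact.M (PF.id (b + a)) (PF.id (b + a))) = cmk PFfact.M (PF.symm a b) (PF.id (b + a))
      rw [ccomp_right, PF.id_comp, injPF.map_symm, cmk_symm])

/-! ### The pushout square -/

theorem Span.mk_eq_comp {A : PROP} [TensorPushouts A.op] {a b n : ℕ} (f : A.Hom n a)
    (g : A.Hom n b) :
    Span.mk f g = (Span A).comp ((spanOfOp A).map f) ((spanOf A).map g) := by
  symm
  refine (ccomp_left (C := A.op) (a := a) (b := n) (c := b) _ f (A.op.id n) g).trans ?_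
  rw [A.op.comp_id (show A.op.Hom a n from f)]; rfl

theorem Span.map_mk {A X : PROP} [TensorPushouts A.op] (F : Span A ⟶ X) {a b n : ℕ}
    (f : A.Hom n a) (g : A.Hom n b) :
    F.map (Span.mk f g) = X.comp ((spanOfOp A ≫ F).map f) ((spanOf A ≫ F).map g) :=
  (congrArg F.map (Span.mk_eq_comp f g)).trans (F.map_comp _ _)

/-- Every span is the opposite of its left leg followed by its right leg, so the two inclusions are
jointly epimorphic. -/
theorem Span.hom_ext {A X : PROP} [TensorPushouts A.op] {F G : Span A ⟶ X}
    (h : spanOf A ≫ F = spanOf A ≫ G) (h' : spanOfOp A ≫ F = spanOfOp A ≫ G) : F = G := by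
  refine PROP.hom_ext ?_
  rintro a b ⟨⟨n, f, g⟩⟩
  refine (Span.map_mk F (n := n) f g).trans (Eq.trans ?_ (Span.map_mk G (n := n) f g).symm)
  rw [h, h']

theorem Cospan.mk_eq_comp {C : PROP} [TensorPushouts C] {a b n : ℕ} (f : C.Hom a n)
    (g : C.Hom b n) :
    Cospan.mk f g = (Cospan C).comp ((cospanOf C).map f) ((cospanOfOp C).map g) := by
  refine ((ccomp_left _ f (C.id n) g).trans ?_).symm
  rw [C.comp_id]; rfl

/-- For `u = v` this isolates an arrow between apexes as a middle factor of its own, to which a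
relation can then be applied. -/
theorem Cospan.comp_mk_comp {C : PROP} [TensorPushouts C] {a b n m : ℕ} (f : C.Hom a n)
    (g : C.Hom b n) (u : C.Hom n m) (v : C.Hom n m) :
    (Cospan C).comp ((cospanOf C).map f) ((Cospan C).comp (Cospan.mk u v) ((cospanOfOp C).map g)) =
      Cospan.mk (C.comp f u) (C.comp g v) :=
  (congrArg _ (ccomp_right _ u v g)).trans (ccomp_left _ f u (C.comp g v))

/-- The span composite of an injection with its opposite is the identity. -/
theorem spanOf_comp_spanOfOp {n m : ℕ} (f : Inj.Hom n m) :
    (Span Inj).comp ((spanOf Inj).map f) ((spanOfOp Inj).map f) = (Span Inj).id n :=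
  (ccomp_eq (C := Inj.op) (MorphismProperty.isomorphisms Inj.op.Ob) (a := n) (b := m) (c := n)
    (Inj.op.id n) f f (Inj.op.id n) ((Inj.isPushout_op_iff f f (.refl _) (.refl _)).2
      -- Injectivity of `f` says that its pullback along itself is given by identities.
      ⟨fun _ => rfl, fun x _ h => ⟨x, rfl, f.injective h⟩⟩)).trans rfl

/-! ### Commutativity and universal property of the square -/

/-- The universal property of the coproduct replaces a commuting square by two equations, one on
injections and one on their opposites; nothing else about the coproduct is needed. -/
theorem toSpanInj_comp_eq_iff {X : PROP} (F : Span Inj ⟶ X) (G : Cospan PF ⟶ X) :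
    toSpanInj ≫ F = toCospanPF ≫ G ↔ spanOf Inj ≫ F = injPF ≫ cospanOf PF ≫ G ∧
      spanOfOp Inj ≫ F = Mor.op injPF ≫ cospanOfOp PF ≫ G := by
  simp only [toSpanInj, toCospanPF, coprod.desc_comp, Category.assoc]
  constructor
  · intro h
    have h1 := congrArg (fun K => coprod.inl ≫ K) h
    have h2 := congrArg (fun K => coprod.inr ≫ K) h
    simp only [coprod.inl_desc, coprod.inr_desc] at h1 h2
    exact ⟨h1, h2⟩
  · rintro ⟨h1, h2⟩
    rw [h1, h2]

/-- On each generator one leg of the span is an identity, so one of the two factors of `spanCorel`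
is an identity corelation. -/
theorem spanToCorel_square :
    toSpanInj ≫ spanToCorel = toCospanPF ≫ toCorel PF PFfact := by
  refine (toSpanInj_comp_eq_iff _ _).2 ⟨PROP.hom_ext fun {a b} f => ?_,
    PROP.hom_ext fun {a b} f => ?_⟩
  · change spanCorel (Inj.id a) f = cmk PFfact.M (injPF.map f) (PF.id b)
    exact (ccomp_left _ _ _ _).trans (by rw [PF.id_comp])
  · change spanCorel f (Inj.id b) = cmk PFfact.M (PF.id a) (injPF.map f)
    exact (ccomp_right _ _ _ _).trans (by rw [PF.id_comp])

/-- A cospan with both legs equal to an injection becomes an identity under a compatible morphism. -/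
theorem map_mk_self {X : PROP} {F : Span Inj ⟶ X} {G : Cospan PF ⟶ X}
    (h : toSpanInj ≫ F = toCospanPF ≫ G) {n m : ℕ} (f : Inj.Hom n m) :
    G.map (Cospan.mk (injPF.map f) (injPF.map f)) = X.id n := by
  obtain ⟨h1, h2⟩ := (toSpanInj_comp_eq_iff F G).1 h
  have e1 : F.map ((spanOf Inj).map f) = G.map ((cospanOf PF).map (injPF.map f)) :=
    congrArg (fun K : Inj ⟶ X => K.map f) h1
  have e2 : F.map ((spanOfOp Inj).map f) = G.map ((cospanOfOp PF).map (injPF.map f)) :=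
    congrArg (fun K : Inj.op ⟶ X => K.map (a := m) (b := n) f) h2
  -- The cospan splits as `f` followed by its opposite. Compatibility moves both factors to spans,
  -- where their composite is an identity.
  rw [Cospan.mk_eq_comp, G.map_comp, ← e1, ← e2]
  exact (F.map_comp _ _).symm.trans ((congrArg F.map (spanOf_comp_spanOfOp f)).trans (F.map_id n))

/-- The morphism out of corelations induced by a compatible pair of morphisms. -/
def corelDesc {X : PROP} {F : Span Inj ⟶ X} {G : Cospan PF ⟶ X}
    (h : toSpanInj ≫ F = toCospanPF ≫ G) : Corel PF PFfact ⟶ X :=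
  have hG : ∀ {a b : ℕ} (s t : Cosp PF a b), CospRel PFfact.M s t →
      G.map (Cospan.mk s.left s.right) = G.map (Cospan.mk t.left t.right) := by
    rintro a b ⟨n, f, g⟩ ⟨n', f', g'⟩ ⟨(m : PF.Hom n n'), hm, hl, hr⟩
    obtain rfl : PF.comp f m = f' := hl
    obtain rfl : PF.comp g m = g' := hr
    -- The class `M` consists exactly of the arrows coming from `Inj`, which is why the relations
    -- imposed by spans suffice.
    obtain ⟨μ, rfl⟩ : ∃ μ : Inj.Hom n n', m = injPF.map μ := hm.imp fun _ h => funext h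
    dsimp only
    -- The cospan enlarged by the injection is `f`, then the cospan with both legs equal to it, then
    -- the opposite of `g`; `G` sends the middle factor to an identity.
    rw [← Cospan.comp_mk_comp, G.map_comp, G.map_comp, map_mk_self h, X.id_comp, ← G.map_comp,
      ← Cospan.mk_eq_comp]
  Mor.mk (P := Corel PF PFfact) (Q := X)
    (Quot.lift (fun s => G.map (Cospan.mk s.left s.right)) hG)
    (fun a => G.map_id a)
    (by
      rintro a b c ⟨⟨n, f, g⟩⟩ ⟨⟨n', f', g'⟩⟩
      -- One pushout computes the composite both in cospans and in corelations, so functoriality is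
      -- inherited from `G`.
      obtain ⟨p, i, j, h⟩ := exists_pushout g f'
      refine (congrArg _ (ccomp_eq PFfact.M f g f' g' h)).trans (Eq.trans ?_
        (G.map_comp (Cospan.mk f g) (Cospan.mk f' g')))
      exact congrArg G.map (ccomp_eq _ f g f' g' h).symm)
    (by
      rintro a b c d ⟨⟨n, f, g⟩⟩ ⟨⟨n', f', g'⟩⟩
      exact G.map_tensor (Cospan.mk f g) (Cospan.mk f' g'))
    (fun a b => G.map_symm a b)

theorem toCorel_corelDesc {X : PROP} {F : Span Inj ⟶ X} {G : Cospan PF ⟶ X}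
    (h : toSpanInj ≫ F = toCospanPF ≫ G) : toCorel PF PFfact ≫ corelDesc h = G := by
  refine PROP.hom_ext ?_
  rintro a b ⟨s⟩
  rfl

/-- The quotient morphism is surjective on arrows, hence an epimorphism. -/
theorem toCorel_cancel {X : PROP} {H K : Corel PF PFfact ⟶ X}
    (h : toCorel PF PFfact ≫ H = toCorel PF PFfact ≫ K) : H = K := by
  refine PROP.hom_ext ?_
  rintro a b ⟨s⟩
  exact congrArg (fun L : Cospan PF ⟶ X => L.map (Cospan.mk s.left s.right)) h

theorem isPushout_spanToCorel :
    IsPushout toSpanInj toCospanPF spanToCorel (toCorel PF PFfact) := by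
  refine IsPushout.mk' spanToCorel_square (fun _ _ _ _ h => toCorel_cancel h) ?_
  intro X F G h
  refine ⟨corelDesc h, ?_, toCorel_corelDesc h⟩
  -- Both `spanToCorel ≫ corelDesc h` and `F` are compatible with the same `G`. They thus agree on
  -- injections and on their opposites, which generate all spans.
  have h1 := spanToCorel_square =≫ corelDesc h
  rw [Category.assoc, Category.assoc, toCorel_corelDesc, ← h] at h1
  obtain ⟨h2, h3⟩ := (toSpanInj_comp_eq_iff (spanToCorel ≫ corelDesc h) G).1 (h1.trans h)
  obtain ⟨h4, h5⟩ := (toSpanInj_comp_eq_iff F G).1 h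
  exact Span.hom_ext (h2.trans h4.symm) (h3.trans h5.symm)

end PROP

theorem mainTheorem10 :
    ∃ (φ : PROP.Corel PROP.PF PROP.PFfact ≅ PROP.PER)
      (Ψ : PROP.Span PROP.Inj ⟶ PROP.Corel PROP.PF PROP.PFfact),
      (∀ (a b n : ℕ) (f : PROP.PF.Hom a n) (g : PROP.PF.Hom b n),
        φ.hom.map (PROP.Corel.mk PROP.PFfact f g) = PERel.ker (Sum.elim f g)) ∧
      (∀ (a b n p : ℕ) (f : PROP.Inj.Hom n a) (g : PROP.Inj.Hom n b)
        (i : PROP.PF.Hom a p) (j : PROP.PF.Hom b p),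
        IsPushout (C := PROP.PF.Ob) (PROP.injPF.map f) (PROP.injPF.map g) i j →
          Ψ.map (PROP.Span.mk f g) = PROP.Corel.mk PROP.PFfact i j) ∧
      IsPushout PROP.toSpanInj PROP.toCospanPF Ψ (PROP.toCorel PROP.PF PROP.PFfact) ∧
      IsPushout PROP.toSpanInj PROP.toCospanPF (Ψ ≫ φ.hom)
        (PROP.toCorel PROP.PF PROP.PFfact ≫ φ.hom) := by
  refine ⟨PROP.corelIsoPER, PROP.spanToCorel, fun _ _ _ _ _ => rfl,
    fun _ _ _ _ f g i j h => PROP.spanCorel_of_isPushout f g i j h,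
    PROP.isPushout_spanToCorel, ?_⟩
  -- Only the last corner of the square changes, by the isomorphism with `PER`.
  exact PROP.isPushout_spanToCorel.of_iso (Iso.refl _) (Iso.refl _) (Iso.refl _)
    PROP.corelIsoPER (by simp) (by simp) (by simp) (by simp)
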